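/- Let $K\in\{\mathbb{R},\mathbb{C},\mathbb{H}\}$, let $d,N\ge 1$ be integers, and equip $K^d$ with the Hermitian product $\langle x,y\rangle=x^*y$ and the norm $|x|=\langle x,x\rangle^{1/2}$. Put $$\beta=\sqrt{\frac{1}{d+2(\dim_{\mathbb{R}}K)^{-1}}},\qquad M=d+\frac{d^2-d}{2}\dim_{\mathbb{R}}K .$$ Let $\{y_1,\dots,y_N\}$ be a finite multiset of vectors in $K^d$ that is a tight frame with frame constant $N/d$, that is, $\sum_{i=1}^N|\langle x,y_i\rangle|^2=\frac Nd|x|^2$ for all $x\in K^d$. Then, for every real $q\in[1,2]$, $$\sum_{i\neq j}|\langle y_i,y_j\rangle|^q\le N^2\left(\beta^q+\frac{1-\beta^q}{M}\right)-N ,$$ where the sum is over ordered pairs of distinct indices in $\{1,\dots,N\}$. If $q\in[1,2)$, then equality holds if and only if the frame consists of unit-length representatives of a maximal simplex in $K\mathbb{P}^{d-1}$, i.e. every $y_i$ has length $1$ and the set of points of $K\mathbb{P}^{d-1}$ represented by $y_1,\dots,y_N$ is a maximal simplex (a point may be represented by several of the $y_i$). Here $K\mathbb{P}^{d-1}=(K^d\setminus\{0\})/K^\times$,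 where $x\sim xe$ for $e\in K^\times$, and a maximal simplex in $K\mathbb{P}^{d-1}$ is a set of exactly $M$ distinct points such that $|\langle u,v\rangle|$ has the same value for unit-length representatives $u,v$ of any two different points of the set. -/

import Mathlib

open scoped Quaternion

noncomputable section

namespace ProjFrame

/-- `K^d` with its Euclidean norm `|x| = (∑ k, ‖x k‖ ^ 2) ^ (1/2)`. -/
abbrev Vec (K : Type) (d : ℕ) : Type := EuclideanSpace K (Fin d)

section

variable {K : Type} [NormedDivisionRing K] [StarRing K] {d N : ℕ}

/-- The standard Hermitian product `⟨x, y⟩ = x^* y = ∑ k, conj (x k) * y k`. -/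
def herm (x y : Vec K d) : K := ∑ k, star (x k) * y k

variable (K d) in
/-- The projective space `K P^{d-1} = (K^d \ {0}) / K^×`, where the nonzero scalars act by right
multiplication, `x ~ x e`: a right `K`-module is a module over the opposite ring. -/
abbrev ProjSpace : Type := Projectivization Kᵐᵒᵖ (Vec K d)

/-- `u` is a unit-length representative of the projective point `p`. -/
def IsUnitRep (u : Vec K d) (p : ProjSpace K d) : Prop :=
  ‖u‖ = 1 ∧ ∃ hu : u ≠ 0, Projectivization.mk Kᵐᵒᵖ u hu = p

/-- A regular simplex: a finite set of (distinct) projective points such that `|⟨u, v⟩|` takes the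
same value for unit-length representatives `u`, `v` of any two different points. -/
def IsRegularSimplex (S : Finset (ProjSpace K d)) : Prop :=
  ∃ α : ℝ, ∀ p ∈ S, ∀ p' ∈ S, p ≠ p' →
    ∀ u v : Vec K d, IsUnitRep u p → IsUnitRep v p' → ‖herm u v‖ = α

/-- The family `y_1, …, y_N` (repetitions allowed) is a tight frame in `K^d` with frame
constant `A`. -/
def IsTightFrame (A : ℝ) (y : Fin N → Vec K d) : Prop :=
  ∀ x : Vec K d, ∑ i, ‖herm x (y i)‖ ^ 2 = A * ‖x‖ ^ 2

/-- The `q`-energy `∑_{i ≠ j} |⟨y_i, y_j⟩| ^ q`, the sum over ordered pairs of different indices. -/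
def energy (q : ℝ) (y : Fin N → Vec K d) : ℝ :=
  ∑ p ∈ (Finset.univ : Finset (Fin N)).offDiag, ‖herm (y p.1) (y p.2)‖ ^ q

variable [NormedAlgebra ℝ K]

variable (K) in
/-- `M = d + (d² - d) / 2 * dim_ℝ K`. -/
def simplexSize (d : ℕ) : ℝ := d + ((d : ℝ) ^ 2 - d) / 2 * (Module.finrank ℝ K : ℝ)

variable (K) in
/-- `β = √(1 / (d + 2 (dim_ℝ K)⁻¹))`. -/
def beta (d : ℕ) : ℝ := √(1 / (d + 2 * (Module.finrank ℝ K : ℝ)⁻¹))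

/-- A maximal simplex: a regular simplex in `K P^{d-1}` with `d + (d² - d) / 2 * dim_ℝ K` points. -/
def IsMaximalSimplex (S : Finset (ProjSpace K d)) : Prop :=
  IsRegularSimplex S ∧ (S.card : ℝ) = simplexSize K d

/-- The family `y` consists of unit-length representatives of a maximal simplex: every `y i`
represents a point of the simplex, and every point of the simplex is represented
(as frames are multisets, a point may be represented several times). -/
def ConsistsOfUnitRepsOfMaximalSimplex (y : Fin N → Vec K d) : Prop :=
  ∃ S : Finset (ProjSpace K d), IsMaximalSimplex S ∧
    (∀ i, ∃ p ∈ S, IsUnitRep (y i) p) ∧ (∀ p ∈ S, ∃ i, IsUnitRep (y i) p)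

variable (K) in
/-- The bound `N² (β^q + (1 - β^q) / M) - N`. -/
def energyBound (d N : ℕ) (q : ℝ) : ℝ :=
  (N : ℝ) ^ 2 * (beta K d ^ q + (1 - beta K d ^ q) / simplexSize K d) - N

end

end ProjFrame

end

/-! Write r_i = |y_i| and B = β², and let t_ij be the squared cosine of the angle between y_i and
y_j, so that |⟨y_i, y_j⟩|^q = r_i^q r_j^q t_ij^(q/2). For d ≥ 2 and q < 2, the power t^(q/2) is
majorized on [0, 1] by the quadratic tangent to it at B and meeting it at 1 (`rpow_lt_hermiteQuad`);
B and 1 are the values of t_ij at a maximal simplex. The leading coefficient is negative, so the sum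
of r_i^q r_j^q t_ij² must be bounded below: this is Cauchy-Schwarz applied to the Hermitian matrices
y_i y_i^* (`design_le`). The linear coefficient is positive, and tightness bounds the sum of r_i^q
r_j^q t_ij above (`sum_rpow_mul_cosSq_le`).

There remains a S² + b N X with S = ∑ r_i^q and X = ∑ r_i^(2q-2). Since ∑ r_i² = N, it is at most N²
(a + b) (`add_mul_le_of_power_sums`); when a ≤ 0 this needs b < q (a + b) (`hermiteSlope_div_lt`).
The value a + b is the desired one because the moments used are those of the distribution with mass
1/M at 1 and the rest at B. The diagonal to be subtracted is at least N.

Equality forces r_i = 1 and t_ij ∈ {B, 1}. Constant row sums then give all points the same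
multiplicity and show that there are M of them (`card_mul_eq`); conversely the same count determines
the angle of a maximal simplex. The cases d = 1 and q = 2 are computed directly. The three choices
of K are treated at once through `IsHermitianCoords`. -/

/-! ### Quadratic Hermite majorant of a concave power. -/

section HermiteInterpolation

/-- A function `k₀ + k₁ t + k₂ t² - p t ^ (p - 1)` with `0 < p < 1` and `k₂ ≤ 0` does not have three
positive zeros. -/
lemma not_three_zeros_quadratic_sub_rpow {p k₀ k₁ k₂ : ℝ} (hp0 : 0 < p) (hp1 : p < 1)
    (hk : k₂ ≤ 0) {u v w : ℝ} (hu : 0 < u) (huv : u < v) (hvw : v < w)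
    (h1 : k₀ + k₁ * u + k₂ * u ^ 2 - p * u ^ (p - 1) = 0)
    (h2 : k₀ + k₁ * v + k₂ * v ^ 2 - p * v ^ (p - 1) = 0)
    (h3 : k₀ + k₁ * w + k₂ * w ^ 2 - p * w ^ (p - 1) = 0) : False := by
  have hder : ∀ t : ℝ, 0 < t → HasDerivAt (fun t : ℝ => k₀ + k₁ * t + k₂ * t ^ 2 - p * t ^ (p - 1))
      (k₁ + 2 * k₂ * t + p * (1 - p) * t ^ (p - 2)) t := by
    intro t ht
    have e1 := (Real.hasDerivAt_rpow_const (x := t) (p := p - 1) (Or.inl ht.ne')).const_mul p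
    have e2 := (((hasDerivAt_id t).const_mul k₁).const_add k₀).add
      (((hasDerivAt_id t).pow 2).const_mul k₂)
    refine (e2.sub e1).congr_deriv ?_
    rw [show p - 1 - 1 = p - 2 by ring]
    simp
    ring
  have rolle : ∀ a b : ℝ, 0 < a → a < b → k₀ + k₁ * a + k₂ * a ^ 2 - p * a ^ (p - 1) = 0 →
      k₀ + k₁ * b + k₂ * b ^ 2 - p * b ^ (p - 1) = 0 →
      ∃ z, a < z ∧ z < b ∧ k₁ + 2 * k₂ * z + p * (1 - p) * z ^ (p - 2) = 0 := by
    intro a b ha hab h h'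
    obtain ⟨z, hz, hz'⟩ := exists_hasDerivAt_eq_zero hab
      (fun t ht => (hder t (ha.trans_le ht.1)).continuousAt.continuousWithinAt) (by rw [h, h'])
      (fun t ht => hder t (ha.trans ht.1))
    exact ⟨z, hz.1, hz.2, hz'⟩
  obtain ⟨y, hy1, hy2, hy⟩ := rolle u v hu huv h1 h2
  obtain ⟨z, hz1, hz2, hz⟩ := rolle v w (hu.trans huv) hvw h2 h3
  -- The derivative is strictly decreasing, since `k₂ ≤ 0` and `p - 2 < 0`, so it cannot vanish at
  -- both `y` and `z`.
  have hlt : z ^ (p - 2) < y ^ (p - 2) :=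
    Real.rpow_lt_rpow_of_neg (hu.trans hy1) (hy2.trans hz1) (by linarith)
  have hpp : 0 < p * (1 - p) := mul_pos hp0 (by linarith)
  nlinarith [mul_lt_mul_of_pos_left hlt hpp, mul_nonneg (neg_nonneg.2 hk) (sub_nonneg.2 (hy2.trans hz1).le)]

/-- The leading coefficient of the quadratic polynomial that agrees with `t ^ p` to second order
at `B` and to first order at `1`. -/
noncomputable def hermiteCoeff (p B : ℝ) : ℝ := ((1 - B ^ p) / (1 - B) - p * B ^ p / B) / (1 - B)

/-- The quadratic polynomial that agrees with `t ^ p` to second order at `B` and to first order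
at `1`. -/
noncomputable def hermiteQuad (p B t : ℝ) : ℝ :=
  B ^ p + p * B ^ p / B * (t - B) + hermiteCoeff p B * (t - B) ^ 2

lemma hermiteQuad_self (p B : ℝ) : hermiteQuad p B B = B ^ p := by
  simp [hermiteQuad]

lemma hermiteQuad_one {p B : ℝ} (hB1 : B < 1) : hermiteQuad p B 1 = 1 := by
  have : 1 - B ≠ 0 := by linarith
  unfold hermiteQuad hermiteCoeff
  field_simp
  ring

/-- By strict concavity the chord from `B` to `1` is less steep than the tangent at `B`; this is
strict Bernoulli at `1 / B`. -/
lemma hermiteCoeff_neg {p B : ℝ} (hp0 : 0 < p) (hp1 : p < 1) (hB0 : 0 < B) (hB1 : B < 1) :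
    hermiteCoeff p B < 0 := by
  have h1B : 0 < 1 - B := by linarith
  have hx : 0 < B ^ p := Real.rpow_pos_of_pos hB0 p
  have hb := rpow_one_add_lt_one_add_mul_self (s := 1 / B - 1) (p := p)
    (by have := one_div_pos.2 hB0; linarith)
    (by have := one_lt_one_div hB0 hB1; intro h; linarith) hp0 hp1
  rw [show 1 + (1 / B - 1) = B⁻¹ by rw [one_div]; ring, Real.inv_rpow hB0.le] at hb
  refine div_neg_of_neg_of_pos ?_ h1B
  rw [sub_neg, div_lt_div_iff₀ h1B hB0]
  have := mul_lt_mul_of_pos_left hb (mul_pos hx hB0)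
  have e1 : B ^ p * B * (B ^ p)⁻¹ = B := by field_simp
  have e2 : B ^ p * B * (1 + p * (1 / B - 1)) = B ^ p * B + p * B ^ p * (1 - B) := by
    field_simp
  rw [e1, e2] at this
  linarith

/-- The Hermite interpolation polynomial lies strictly above `t ^ p` on `[0, 1]`, except at the
interpolation points. -/
lemma rpow_lt_hermiteQuad {p B t : ℝ} (hp0 : 0 < p) (hp1 : p < 1) (hB0 : 0 < B) (hB1 : B < 1)
    (ht0 : 0 ≤ t) (ht1 : t ≤ 1) (htB : t ≠ B) (ht : t ≠ 1) : t ^ p < hermiteQuad p B t := by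
  by_contra! hcon
  have ht1' : t < 1 := lt_of_le_of_ne ht1 ht
  have hw : 0 < (t - B) ^ 2 * (1 - t) :=
    mul_pos (by have := sub_ne_zero.2 htB; positivity) (by linarith)
  set c := hermiteCoeff p B with hc
  set x := B ^ p with hx
  -- `K` is chosen so that the corrected difference `G` vanishes at `t` as well as at `B` and `1`.
  -- As `B` is a double zero, Rolle gives `G'` three zeros, while `K ≤ 0` puts `G'` in the form
  -- excluded above.
  obtain ⟨K, hK⟩ : ∃ K, K = (hermiteQuad p B t - t ^ p) / ((t - B) ^ 2 * (1 - t)) := ⟨_, rfl⟩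
  have hK0 : K ≤ 0 := by rw [hK]; exact div_nonpos_of_nonpos_of_nonneg (by linarith) hw.le
  have hKe : K * ((t - B) ^ 2 * (1 - t)) = hermiteQuad p B t - t ^ p := by
    rw [hK, div_mul_cancel₀ _ hw.ne']
  obtain ⟨G, hG⟩ : ∃ G : ℝ → ℝ, G = fun s => hermiteQuad p B s - K * ((s - B) ^ 2 * (1 - s)) - s ^ p :=
    ⟨_, rfl⟩
  obtain ⟨G', hG'⟩ : ∃ G' : ℝ → ℝ, G' = fun s => (p * x / B - 2 * c * B + K * (2 * B + B ^ 2)) +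
      (2 * c - K * (2 + 4 * B)) * s + (3 * K) * s ^ 2 - p * s ^ (p - 1) := ⟨_, rfl⟩
  have hder : ∀ s, 0 < s → HasDerivAt G (G' s) s := by
    intro s hs
    have e1 := Real.hasDerivAt_rpow_const (x := s) (p := p) (Or.inl hs.ne')
    have e0 := (hasDerivAt_id s).sub_const B
    have e2 := ((e0.const_mul (p * x / B)).const_add x).add ((e0.pow 2).const_mul c)
    have e3 := ((e0.pow 2).mul ((hasDerivAt_id s).const_sub 1)).const_mul K
    rw [hG, hG']
    refine ((e2.sub e3).sub e1).congr_deriv ?_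
    simp
    ring
  have hcont : Continuous G := by
    rw [hG]
    unfold hermiteQuad
    have := Real.continuous_rpow_const hp0.le
    fun_prop
  have hGB : G B = 0 := by rw [hG]; simp [hermiteQuad_self]
  have hG1 : G 1 = 0 := by rw [hG]; simp [hermiteQuad_one hB1]
  have hGt : G t = 0 := by rw [hG]; simp only; rw [hKe]; ring
  have hG'B : G' B = 0 := by
    rw [hG']
    simp only
    rw [Real.rpow_sub_one hB0.ne', ← hx]
    ring
  have rolle : ∀ a b, 0 ≤ a → a < b → G a = 0 → G b = 0 → ∃ z, a < z ∧ z < b ∧ G' z = 0 := by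
    intro a b ha hab h h'
    obtain ⟨z, hz, hz'⟩ := exists_hasDerivAt_eq_zero hab hcont.continuousOn (by rw [h, h'])
      (fun s hs => hder s (ha.trans_lt hs.1))
    exact ⟨z, hz.1, hz.2, hz'⟩
  rw [hG'] at hG'B rolle
  rcases lt_or_gt_of_ne htB with h | h
  · obtain ⟨y, hy1, hy2, hy⟩ := rolle t B ht0 h hGt hGB
    obtain ⟨z, hz1, hz2, hz⟩ := rolle B 1 hB0.le hB1 hGB hG1
    exact not_three_zeros_quadratic_sub_rpow hp0 hp1 (by linarith) (ht0.trans_lt hy1) hy2 hz1 hy hG'B hz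
  · obtain ⟨y, hy1, hy2, hy⟩ := rolle B t hB0.le h hGB hGt
    obtain ⟨z, hz1, hz2, hz⟩ := rolle t 1 ht0 ht1' hGt hG1
    exact not_three_zeros_quadratic_sub_rpow hp0 hp1 (by linarith) hB0 hy1 (hy2.trans hz1) hG'B hy hz

lemma rpow_le_hermiteQuad {p B t : ℝ} (hp0 : 0 < p) (hp1 : p < 1) (hB0 : 0 < B) (hB1 : B < 1)
    (ht0 : 0 ≤ t) (ht1 : t ≤ 1) : t ^ p ≤ hermiteQuad p B t := by
  by_cases htB : t = B
  · rw [htB, hermiteQuad_self]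
  by_cases ht : t = 1
  · rw [ht, hermiteQuad_one hB1, Real.one_rpow]
  exact (rpow_lt_hermiteQuad hp0 hp1 hB0 hB1 ht0 ht1 htB ht).le

end HermiteInterpolation

/-! ### The numerical inequality that controls the linear coefficient. -/

section LinearCoefficient

/-- The power `B ^ (q / 2)` lies below its chord over `1 ≤ q ≤ 2`. -/
lemma rpow_half_le_chord {B s q : ℝ} (hB : 0 < B) (hs : 0 ≤ s) (hBs : B ≤ s ^ 2)
    (hq1 : 1 ≤ q) (hq2 : q ≤ 2) : B ^ (q / 2) ≤ s * (2 - q) + B * (q - 1) := by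
  have h0 := Real.sqrt_pos.2 hB
  have hsq : √B * √B = B := Real.mul_self_sqrt hB.le
  -- The true chord has `√B` in place of `s`; an upper bound `s` allows rational values in the case
  -- check below.
  have hle : √B ≤ s := (Real.sqrt_le_left hs).2 hBs
  have e : B ^ (q / 2) = √B * √B ^ (q - 1) := by
    rw [Real.rpow_sub_one h0.ne', Real.sqrt_eq_rpow, ← Real.rpow_mul hB.le,
      show 1 / 2 * q = q / 2 by ring]
    field_simp
  have hb := rpow_one_add_le_one_add_mul_self (s := √B - 1) (p := q - 1) (by linarith)
    (by linarith) (by linarith)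
  rw [show 1 + (√B - 1) = √B by ring] at hb
  rw [e]
  nlinarith [mul_le_mul_of_nonneg_left hb h0.le, mul_le_mul_of_nonneg_right hle (by linarith : 0 ≤ 2 - q)]

/-- The inequality `0 < q x (1 - (3 + 2 μ) B) + 2 μ B² q + 4 B² (1 - x) / (1 - B)` for
`x = B ^ (q / 2)`, `μ = 2 / m`, `1 / B = d + μ`. -/
lemma slope_aux {d : ℕ} (hd : 2 ≤ d) {m q B : ℝ} (hm : m = 1 ∨ m = 2 ∨ m = 4)
    (hB : B = 1 / (d + 2 / m)) (hq1 : 1 ≤ q) (hq2 : q < 2) :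
    0 < q * B ^ (q / 2) * (1 - (3 + 2 * (2 / m)) * B) + 2 * (2 / m) * B ^ 2 * q +
      4 * B ^ 2 * (1 - B ^ (q / 2)) / (1 - B) := by
  have hd2 : (2 : ℝ) ≤ d := by exact_mod_cast hd
  have hm0 : 0 < m := by rcases hm with rfl | rfl | rfl <;> norm_num
  have hD : 0 < (d : ℝ) + 2 / m := by positivity
  have hB0 : 0 < B := by rw [hB]; positivity
  have hB1 : B < 1 := by
    rw [hB, div_lt_one hD]; have : 0 < 2 / m := by positivity
    linarith
  have hx0 : 0 < B ^ (q / 2) := Real.rpow_pos_of_pos hB0 _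
  have hx1 : B ^ (q / 2) < 1 := Real.rpow_lt_one hB0.le hB1 (by linarith)
  have h3 : 0 < 4 * B ^ 2 * (1 - B ^ (q / 2)) / (1 - B) :=
    div_pos (mul_pos (by positivity) (by linarith)) (by linarith)
  by_cases hk : 0 ≤ 1 - (3 + 2 * (2 / m)) * B
  · have : 0 ≤ q * B ^ (q / 2) * (1 - (3 + 2 * (2 / m)) * B) := by positivity
    have : 0 ≤ 2 * (2 / m) * B ^ 2 * q := by positivity
    linarith
  have hch := fun s hs hBs => rpow_half_le_chord (B := B) (s := s) (q := q) hB0 hs hBs hq1 hq2.le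
  -- A negative coefficient leaves only seven pairs `(m, d)`.
  have hdlt : (d : ℝ) < 3 + 2 / m := by
    rw [hB] at hk
    rw [not_le, mul_one_div, sub_neg, lt_div_iff₀ hD] at hk
    linarith
  -- Now the expression decreases in `B ^ (q / 2)`, so the larger chord value may replace it, which
  -- leaves a quadratic polynomial in `q`. The values of `s` below are rational upper bounds for
  -- `√B`.
  have key : ∀ s κ : ℝ, κ = 1 - (3 + 2 * (2 / m)) * B → 0 ≤ s → B ≤ s ^ 2 →
      0 < q * (s * (2 - q) + B * (q - 1)) * κ + 2 * (2 / m) * B ^ 2 * q +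
        4 * B ^ 2 * (1 - (s * (2 - q) + B * (q - 1))) / (1 - B) →
      0 < q * B ^ (q / 2) * (1 - (3 + 2 * (2 / m)) * B) + 2 * (2 / m) * B ^ 2 * q +
        4 * B ^ 2 * (1 - B ^ (q / 2)) / (1 - B) := by
    intro s κ hκ hs hBs h
    rw [← hκ] at hk ⊢
    have hx := hch s hs hBs
    have i1 : q * (s * (2 - q) + B * (q - 1)) * κ ≤ q * B ^ (q / 2) * κ := by
      have := mul_le_mul_of_nonneg_left hx (by linarith : 0 ≤ q)
      nlinarith
    have i2 : 4 * B ^ 2 * (1 - (s * (2 - q) + B * (q - 1))) / (1 - B) ≤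
        4 * B ^ 2 * (1 - B ^ (q / 2)) / (1 - B) := by
      have : 0 < 1 - B := by linarith
      gcongr
    linarith
  rcases hm with rfl | rfl | rfl
  · have : d < 5 := by have : (d : ℝ) < 5 := by linarith
                       exact_mod_cast this
    interval_cases d
    · norm_num at hB; subst hB
      apply key (1 / 2) _ rfl <;> norm_num; nlinarith
    · norm_num at hB; subst hB
      apply key (9 / 20) _ rfl <;> norm_num; nlinarith
    · norm_num at hB; subst hB
      apply key (41 / 100) _ rfl <;> norm_num; nlinarith
  · have : d < 4 := by have : (d : ℝ) < 4 := by linarith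
                       exact_mod_cast this
    interval_cases d
    · norm_num at hB; subst hB
      apply key (29 / 50) _ rfl <;> norm_num; nlinarith
    · norm_num at hB; subst hB
      apply key (1 / 2) _ rfl <;> norm_num; nlinarith
  · have : d < 4 := by have : (d : ℝ) < 4 := by linarith
                       exact_mod_cast this
    interval_cases d
    · norm_num at hB; subst hB
      apply key (16 / 25) _ rfl <;> norm_num; nlinarith
    · norm_num at hB; subst hB
      apply key (27 / 50) _ rfl <;> norm_num; nlinarith

end LinearCoefficient

/-! ### Power sums of the lengths. -/

section PowerMeans

/-- Tangent line in the variable `r ^ 2` at `1`: after summation the linear term vanishes because ∑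
r_i² is the number of terms. -/
lemma rpow_le_one_add_sq {r p : ℝ} (hr : 0 ≤ r) (hp0 : 0 ≤ p) (hp2 : p ≤ 2) :
    r ^ p ≤ 1 + p / 2 * (r ^ 2 - 1) := by
  have h := rpow_one_add_le_one_add_mul_self (s := r ^ 2 - 1) (p := p / 2)
    (by nlinarith) (by linarith) (by linarith)
  rwa [show 1 + (r ^ 2 - 1) = r ^ (2 : ℝ) by rw [Real.rpow_two]; ring, ← Real.rpow_mul hr,
    show 2 * (p / 2) = p by ring] at h

lemma rpow_lt_one_add_sq {r p : ℝ} (hr : 0 ≤ r) (hr1 : r ≠ 1) (hp0 : 0 < p) (hp2 : p < 2) :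
    r ^ p < 1 + p / 2 * (r ^ 2 - 1) := by
  have h := rpow_one_add_lt_one_add_mul_self (s := r ^ 2 - 1) (p := p / 2) (by nlinarith)
    (by rw [Ne, sub_eq_zero, pow_eq_one_iff_of_nonneg hr two_ne_zero]; exact hr1)
    (by linarith) (by linarith)
  rwa [show 1 + (r ^ 2 - 1) = r ^ (2 : ℝ) by rw [Real.rpow_two]; ring, ← Real.rpow_mul hr,
    show 2 * (p / 2) = p by ring] at h

lemma one_add_sq_le_rpow {r q : ℝ} (hr : 0 ≤ r) (hq : 1 ≤ q) :
    1 + q * (r ^ 2 - 1) ≤ r ^ (2 * q) := by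
  have h := one_add_mul_self_le_rpow_one_add (s := r ^ 2 - 1) (p := q) (by nlinarith) hq
  rwa [show 1 + (r ^ 2 - 1) = r ^ (2 : ℝ) by rw [Real.rpow_two]; ring, ← Real.rpow_mul hr] at h

lemma one_add_sq_lt_rpow {r q : ℝ} (hr : 0 ≤ r) (hr1 : r ≠ 1) (hq : 1 < q) :
    1 + q * (r ^ 2 - 1) < r ^ (2 * q) := by
  have h := one_add_mul_self_lt_rpow_one_add (s := r ^ 2 - 1) (p := q) (by nlinarith)
    (by rw [Ne, sub_eq_zero, pow_eq_one_iff_of_nonneg hr two_ne_zero]; exact hr1) hq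
  rwa [show 1 + (r ^ 2 - 1) = r ^ (2 : ℝ) by rw [Real.rpow_two]; ring, ← Real.rpow_mul hr] at h

/-- Bernoulli's inequality in the form comparing the powers `r ^ q` and `r ^ (2 q - 2)`. -/
lemma one_add_rpow_two_mul_sub_two_le {r q : ℝ} (hr : 0 ≤ r) (hq1 : 1 < q) (hq2 : q ≤ 2) :
    1 + q / (2 * q - 2) * (r ^ (2 * q - 2) - 1) ≤ r ^ q := by
  have h := one_add_mul_self_le_rpow_one_add (s := r ^ (2 * q - 2) - 1) (p := q / (2 * q - 2))
    (by have := Real.rpow_nonneg hr (2 * q - 2); linarith)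
    (by rw [le_div_iff₀ (by linarith)]; linarith)
  rwa [add_sub_cancel, ← Real.rpow_mul hr, mul_div_cancel₀ _ (by linarith : 2 * q - 2 ≠ 0)] at h

variable {ι : Type*} [Fintype ι] {r : ι → ℝ} {p q : ℝ}

lemma sum_rpow_le_card (hr : ∀ i, 0 ≤ r i) (hsum : ∑ i, r i ^ 2 = Fintype.card ι) (hp0 : 0 ≤ p)
    (hp2 : p ≤ 2) : ∑ i, r i ^ p ≤ Fintype.card ι := by
  refine (Finset.sum_le_sum fun i _ => rpow_le_one_add_sq (hr i) hp0 hp2).trans (le_of_eq ?_)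
  rw [Finset.sum_add_distrib, ← Finset.mul_sum, Finset.sum_sub_distrib, hsum]
  simp

lemma eq_one_of_sum_rpow_eq_card (hr : ∀ i, 0 ≤ r i) (hsum : ∑ i, r i ^ 2 = Fintype.card ι)
    (hp0 : 0 < p) (hp2 : p < 2) (h : ∑ i, r i ^ p = Fintype.card ι) (i : ι) : r i = 1 := by
  by_contra hi
  have hlt := Finset.sum_lt_sum (fun i _ => rpow_le_one_add_sq (hr i) hp0.le hp2.le)
    ⟨i, Finset.mem_univ i, rpow_lt_one_add_sq (hr i) hi hp0 hp2⟩
  rw [Finset.sum_add_distrib, ← Finset.mul_sum, Finset.sum_sub_distrib, hsum, h] at hlt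
  simp at hlt

lemma card_le_sum_rpow (hr : ∀ i, 0 ≤ r i) (hsum : ∑ i, r i ^ 2 = Fintype.card ι) (hq : 1 ≤ q) :
    (Fintype.card ι : ℝ) ≤ ∑ i, r i ^ (2 * q) := by
  refine le_trans (le_of_eq ?_) (Finset.sum_le_sum fun i _ => one_add_sq_le_rpow (hr i) hq)
  rw [Finset.sum_add_distrib, ← Finset.mul_sum, Finset.sum_sub_distrib, hsum]
  simp

lemma eq_one_of_card_eq_sum_rpow (hr : ∀ i, 0 ≤ r i) (hsum : ∑ i, r i ^ 2 = Fintype.card ι)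
    (hq : 1 < q) (h : ∑ i, r i ^ (2 * q) = Fintype.card ι) (i : ι) : r i = 1 := by
  by_contra hi
  have hlt := Finset.sum_lt_sum (fun i _ => one_add_sq_le_rpow (hr i) hq.le)
    ⟨i, Finset.mem_univ i, one_add_sq_lt_rpow (hr i) hi hq⟩
  rw [Finset.sum_add_distrib, ← Finset.mul_sum, Finset.sum_sub_distrib, hsum, h] at hlt
  simp at hlt

lemma card_sub_sum_rpow_le (hr : ∀ i, 0 ≤ r i) (hq1 : 1 < q) (hq2 : q ≤ 2) :
    Fintype.card ι - ∑ i, r i ^ q ≤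
      q / (2 * q - 2) * (Fintype.card ι - ∑ i, r i ^ (2 * q - 2)) := by
  have h := Finset.sum_le_sum fun i (_ : i ∈ Finset.univ) =>
    one_add_rpow_two_mul_sub_two_le (hr i) hq1 hq2
  rw [Finset.sum_add_distrib, ← Finset.mul_sum, Finset.sum_sub_distrib] at h
  simp only [Finset.sum_const, Finset.card_univ, nsmul_eq_mul, mul_one] at h
  linarith

end PowerMeans

/-! ### The Hermite quadratic at the moments of a 2-design. -/

section MomentIdentities

/-- The bound `β ^ q + (1 - β ^ q) / M` as a function of `B = β²`, `p = q / 2` and `μ = 2 / m`. -/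
noncomputable def momentBound (d μ p B : ℝ) : ℝ := B ^ p + (1 - B ^ p) / (d + (d ^ 2 - d) / μ)

/-- The linear coefficient of the Hermite interpolation polynomial. -/
noncomputable def hermiteSlope (p B : ℝ) : ℝ := p * B ^ p / B - 2 * hermiteCoeff p B * B

lemma hermiteQuad_eq {p B : ℝ} (t : ℝ) :
    hermiteQuad p B t = hermiteQuad p B 0 + hermiteSlope p B * t + hermiteCoeff p B * t ^ 2 := by
  unfold hermiteQuad hermiteSlope
  ring

lemma hermiteSlope_pos {p B : ℝ} (hp0 : 0 < p) (hp1 : p < 1) (hB0 : 0 < B) (hB1 : B < 1) :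
    0 < hermiteSlope p B := by
  have h1 := hermiteCoeff_neg hp0 hp1 hB0 hB1
  have h2 : 0 < p * B ^ p / B := by positivity
  unfold hermiteSlope
  nlinarith

/-- The value of the Hermite polynomial under the moments `1`, `1 / d` and
`(1 + μ) / (d (d + μ))` of a projective 2-design. -/
lemma hermite_moments {d μ p B : ℝ} (hd : 1 ≤ d) (hμ : 0 < μ) (hB : B = 1 / (d + μ)) :
    hermiteQuad p B 0 + hermiteSlope p B / d + hermiteCoeff p B * ((1 + μ) / (d * (d + μ))) =
      momentBound d μ p B := by
  have h1 : d + μ - 1 ≠ 0 := by linarith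
  have h2 : d + μ ≠ 0 := by linarith
  have h3 : d ≠ 0 := by linarith
  have h4 : μ + (d - 1) ≠ 0 := by linarith
  have h6 : 1 - B = (d + μ - 1) / (d + μ) := by rw [hB]; field_simp
  have h5 : d + (d ^ 2 - d) / μ = d * (d + μ - 1) / μ := by field_simp; ring
  unfold hermiteQuad hermiteSlope momentBound hermiteCoeff
  generalize B ^ p = x
  rw [h5, h6, hB]
  field_simp
  ring

/-- This is the condition b < q (a + b) of `add_mul_le_of_power_sums`; the difference of its sides
is a positive multiple of the expression in `slope_aux`. -/
lemma hermiteSlope_div_lt {d : ℕ} (hd : 2 ≤ d) {m q B : ℝ} (hm : m = 1 ∨ m = 2 ∨ m = 4)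
    (hB : B = 1 / (d + 2 / m)) (hq1 : 1 ≤ q) (hq2 : q < 2) :
    hermiteSlope (q / 2) B / d < q * momentBound d (2 / m) (q / 2) B := by
  have hs := slope_aux hd hm hB hq1 hq2
  have hd2 : (2 : ℝ) ≤ d := by exact_mod_cast hd
  have hμ : 0 < 2 / m := by rcases hm with rfl | rfl | rfl <;> norm_num
  generalize 2 / m = μ at *
  have h1 : (d : ℝ) + μ - 1 ≠ 0 := by linarith
  have h2 : (d : ℝ) + μ ≠ 0 := by linarith
  have h3 : (d : ℝ) ≠ 0 := by linarith
  have h6 : 1 - B = (d + μ - 1) / (d + μ) := by rw [hB]; field_simp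
  have h5 : (d : ℝ) + ((d : ℝ) ^ 2 - d) / μ = d * (d + μ - 1) / μ := by field_simp; ring
  have hpos : 0 < (d + μ) ^ 2 / (2 * d * (d + μ - 1)) :=
    div_pos (by positivity) (mul_pos (by linarith) (by linarith))
  have := mul_pos hs hpos
  rw [← sub_pos]
  refine this.trans_eq ?_
  unfold hermiteSlope momentBound hermiteCoeff
  generalize B ^ (q / 2) = x
  rw [h5, h6, hB]
  field_simp
  ring

end MomentIdentities

/-! ### The energy bound in terms of lengths and absolute inner products. -/

section EnergyOfNumbers

/-- The numerical data of a tight frame: `r i` stands for `|y_i|` and `s i j` for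
`|⟨y_i, y_j⟩|`. -/
structure FrameNumbers (d : ℕ) (m : ℝ) {N : ℕ} (r : Fin N → ℝ) (s : Fin N → Fin N → ℝ) : Prop where
  r_nonneg : ∀ i, 0 ≤ r i
  s_nonneg : ∀ i j, 0 ≤ s i j
  s_le : ∀ i j, s i j ≤ r i * r j
  s_self : ∀ i, s i i = r i ^ 2
  sum_sq : ∑ i, r i ^ 2 = N
  tight : ∀ j, ∑ i, s i j ^ 2 = N / d * r j ^ 2
  tight' : ∀ i, ∑ j, s i j ^ 2 = N / d * r i ^ 2
  design : ∀ w : Fin N → ℝ, (1 + 2 / m) / (d * (d + 2 / m)) * (∑ i, (w i * r i ^ 2) ^ 2) ^ 2 ≤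
    ∑ i, ∑ j, (w i * w j * s i j ^ 2) ^ 2
  rank_one : d = 1 → ∀ i j, s i j = r i * r j

variable {d N : ℕ} {m q B : ℝ} {r : Fin N → ℝ} {s : Fin N → Fin N → ℝ}

namespace FrameNumbers

/-- The squared cosine of the angle. -/
noncomputable def cosSq (r : Fin N → ℝ) (s : Fin N → Fin N → ℝ) (i j : Fin N) : ℝ :=
  s i j ^ 2 / (r i ^ 2 * r j ^ 2)

lemma cosSq_nonneg (i j : Fin N) : 0 ≤ cosSq r s i j := by
  unfold cosSq; positivity

lemma cosSq_le_one (h : FrameNumbers d m r s) (i j : Fin N) : cosSq r s i j ≤ 1 := by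
  unfold cosSq
  refine div_le_one_of_le₀ ?_ (by positivity)
  rw [← mul_pow]
  exact pow_le_pow_left₀ (h.s_nonneg i j) (h.s_le i j) 2

lemma rpow_eq (h : FrameNumbers d m r s) (hq : 0 < q) (i j : Fin N) :
    s i j ^ q = r i ^ q * r j ^ q * cosSq r s i j ^ (q / 2) := by
  -- For a zero vector `cosSq` has the default value 0, but `0 < q` makes both sides vanish.
  have h0 : r i * r j = 0 → s i j = 0 := fun e =>
    le_antisymm (e ▸ h.s_le i j) (h.s_nonneg i j)
  have hri := h.r_nonneg i
  have hrj := h.r_nonneg j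
  have hs := h.s_nonneg i j
  by_cases hi : r i * r j = 0
  · rw [h0 hi, ← Real.mul_rpow hri hrj, hi, Real.zero_rpow hq.ne', zero_mul]
  · have e : cosSq r s i j = (s i j / (r i * r j)) ^ (2 : ℝ) := by
      rw [cosSq, Real.rpow_two, div_pow, mul_pow]
    have hpos : 0 < r i * r j := lt_of_le_of_ne (mul_nonneg hri hrj) (Ne.symm hi)
    rw [e, ← Real.rpow_mul (by positivity), show 2 * (q / 2) = q by ring,
      Real.div_rpow hs hpos.le, Real.mul_rpow hri hrj, mul_div_cancel₀]
    have := Real.rpow_pos_of_pos hpos q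
    rw [Real.mul_rpow hri hrj] at this
    exact this.ne'

lemma sq_mul_cosSq (h : FrameNumbers d m r s) (i j : Fin N) :
    r i ^ 2 * cosSq r s i j = s i j ^ 2 / r j ^ 2 := by
  unfold cosSq
  by_cases hi : r i = 0
  · have : s i j = 0 := le_antisymm (by simpa [hi] using h.s_le i j) (h.s_nonneg i j)
    simp [hi, this]
  · field_simp

lemma cosSq_mul_sq (h : FrameNumbers d m r s) (i j : Fin N) :
    r j ^ 2 * cosSq r s i j = s i j ^ 2 / r i ^ 2 := by
  unfold cosSq
  by_cases hi : r j = 0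
  · have : s i j = 0 := le_antisymm (by simpa [hi] using h.s_le i j) (h.s_nonneg i j)
    simp [hi, this]
  · field_simp

/-- By the arithmetic-geometric mean inequality, 2 r_i^q r_j^q ≤ r_i² r_j^(2q-2) + r_j² r_i^(2q-2).
After multiplication by `cosSq`, each half is summed by tightness. -/
lemma sum_rpow_mul_cosSq_le (h : FrameNumbers d m r s) :
    ∑ i, ∑ j, r i ^ q * r j ^ q * cosSq r s i j ≤ N / d * ∑ j, r j ^ (2 * q - 2) := by
  have hpt : ∀ i j, r i ^ q * r j ^ q * cosSq r s i j ≤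
      (r j ^ (2 * q - 2) * (s i j ^ 2 / r j ^ 2) + r i ^ (2 * q - 2) * (s i j ^ 2 / r i ^ 2)) / 2 := by
    intro i j
    rw [← h.sq_mul_cosSq, ← h.cosSq_mul_sq]
    have hri := h.r_nonneg i
    have hrj := h.r_nonneg j
    by_cases h0 : r i * r j = 0
    · have : s i j = 0 := le_antisymm (by simpa [h0] using h.s_le i j) (h.s_nonneg i j)
      simp [cosSq, this]
    have hi : 0 < r i := lt_of_le_of_ne hri (by rintro e; simp [← e] at h0)
    have hj : 0 < r j := lt_of_le_of_ne hrj (by rintro e; simp [← e] at h0)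
    have e : ∀ x : ℝ, 0 < x → x ^ q = x * x ^ (q - 1) ∧ x ^ (2 * q - 2) = (x ^ (q - 1)) ^ 2 := by
      intro x hx
      constructor
      · rw [Real.rpow_sub_one hx.ne']; field_simp
      · rw [← Real.rpow_two, ← Real.rpow_mul hx.le]; ring_nf
    rw [(e _ hi).1, (e _ hj).1, (e _ hi).2, (e _ hj).2]
    have ht := cosSq_nonneg (r := r) (s := s) i j
    nlinarith [mul_nonneg (sq_nonneg (r i * r j ^ (q - 1) - r j * r i ^ (q - 1))) ht]
  -- Only an inequality: if `r j = 0`, division by zero makes the left side 0.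
  have hle : ∀ a : Fin N → ℝ, ∀ j, ∑ i, a i = N / d * r j ^ 2 →
      r j ^ (2 * q - 2) * ((∑ i, a i) / r j ^ 2) ≤ r j ^ (2 * q - 2) * (N / d) := by
    intro a j ha
    refine mul_le_mul_of_nonneg_left ?_ (Real.rpow_nonneg (h.r_nonneg j) _)
    rw [ha]
    by_cases hj : r j = 0
    · simp [hj]; positivity
    · rw [mul_div_cancel_right₀ _ (pow_ne_zero 2 hj)]
  have h1 : ∑ i, ∑ j, r j ^ (2 * q - 2) * (s i j ^ 2 / r j ^ 2) ≤
      N / d * ∑ j, r j ^ (2 * q - 2) := by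
    rw [Finset.sum_comm, Finset.mul_sum]
    refine Finset.sum_le_sum fun j _ => ?_
    rw [← Finset.mul_sum, ← Finset.sum_div, mul_comm (N / d : ℝ)]
    exact hle _ j (h.tight j)
  have h2 : ∑ i, ∑ j, r i ^ (2 * q - 2) * (s i j ^ 2 / r i ^ 2) ≤
      N / d * ∑ j, r j ^ (2 * q - 2) := by
    rw [Finset.mul_sum]
    refine Finset.sum_le_sum fun j _ => ?_
    rw [← Finset.mul_sum, ← Finset.sum_div, mul_comm (N / d : ℝ)]
    exact hle _ j (h.tight' j)
  refine (Finset.sum_le_sum fun i _ => Finset.sum_le_sum fun j _ => hpt i j).trans ?_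
  simp only [← Finset.sum_div, Finset.sum_add_distrib]
  linarith

lemma le_sum_rpow_mul_cosSq_sq (h : FrameNumbers d m r s) (hq : 0 < q) :
    (1 + 2 / m) / (d * (d + 2 / m)) * (∑ i, r i ^ q) ^ 2 ≤
      ∑ i, ∑ j, r i ^ q * r j ^ q * cosSq r s i j ^ 2 := by
  have hsq : ∀ i, (r i ^ (q / 2)) ^ 2 = r i ^ q := fun i => by
    rw [← Real.rpow_two, ← Real.rpow_mul (h.r_nonneg i)]; ring_nf
  -- These weights turn `w i * r i ^ 2` into `r i ^ (q / 2)`.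
  have hd := h.design fun i => r i ^ (q / 2) / r i ^ 2
  convert hd using 2
  · congr 1
    refine Finset.sum_congr rfl fun i _ => ?_
    by_cases hi : r i = 0
    · simp [hi, Real.zero_rpow hq.ne']
    · rw [div_mul_cancel₀ _ (pow_ne_zero 2 hi), hsq]
  · refine Finset.sum_congr rfl fun j _ => ?_
    rw [← hsq, ← hsq, cosSq]
    by_cases hi : r ‹_› = 0
    · simp [hi]
    by_cases hj : r j = 0
    · simp [hj]
    field_simp

/-- The sum of the Hermite majorants. -/
noncomputable def majorant (q B : ℝ) (r : Fin N → ℝ) (s : Fin N → Fin N → ℝ) : ℝ :=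
  ∑ i, ∑ j, r i ^ q * r j ^ q * hermiteQuad (q / 2) B (cosSq r s i j)

lemma majorant_le (h : FrameNumbers d m r s) (hq0 : 0 < q) (hq2 : q < 2) (hB0 : 0 < B)
    (hB1 : B < 1) :
    majorant q B r s ≤ (hermiteQuad (q / 2) B 0 + hermiteCoeff (q / 2) B *
      ((1 + 2 / m) / (d * (d + 2 / m)))) * (∑ i, r i ^ q) ^ 2 +
      hermiteSlope (q / 2) B / d * (N * ∑ j, r j ^ (2 * q - 2)) := by
  have e : majorant q B r s = hermiteQuad (q / 2) B 0 * (∑ i, r i ^ q) ^ 2 +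
      hermiteSlope (q / 2) B * ∑ i, ∑ j, r i ^ q * r j ^ q * cosSq r s i j +
      hermiteCoeff (q / 2) B * ∑ i, ∑ j, r i ^ q * r j ^ q * cosSq r s i j ^ 2 := by
    rw [majorant, sq, Finset.sum_mul_sum]
    simp only [Finset.mul_sum, ← Finset.sum_add_distrib]
    refine Finset.sum_congr rfl fun i _ => Finset.sum_congr rfl fun j _ => ?_
    rw [hermiteQuad_eq]
    ring
  have h1 := mul_le_mul_of_nonneg_left (h.sum_rpow_mul_cosSq_le (q := q))
    (hermiteSlope_pos (p := q / 2) (by linarith) (by linarith) hB0 hB1).le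
  have h2 := mul_le_mul_of_nonpos_left (h.le_sum_rpow_mul_cosSq_sq hq0)
    (hermiteCoeff_neg (p := q / 2) (by linarith) (by linarith) hB0 hB1).le
  rw [e]
  calc _ ≤ _ := add_le_add (add_le_add le_rfl h1) h2
    _ = _ := by ring

/-- For a > 0 both terms are monotone. For a ≤ 0, `hab` excludes q = 1, and `h` lets the gain in b n
(n - X) outweigh the loss 2 a n (n - S); the remainder -a (n - S)² is nonnegative. -/
lemma add_mul_le_of_power_sums {a b q n S X : ℝ} (hq1 : 1 ≤ q) (hb : 0 < b)
    (hab : b < q * (a + b)) (hn : 0 ≤ n) (hS0 : 0 ≤ S) (hS : S ≤ n) (hX : X ≤ n)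
    (h : 1 < q → n - S ≤ q / (2 * q - 2) * (n - X)) :
    a * S ^ 2 + b * (n * X) ≤ n ^ 2 * (a + b) ∧
      (a * S ^ 2 + b * (n * X) = n ^ 2 * (a + b) → 1 < q ∨ S = n) := by
  by_cases ha0 : 0 < a
  · have hbX : b * (n * X) ≤ b * (n * n) :=
      mul_le_mul_of_nonneg_left (mul_le_mul_of_nonneg_left hX hn) hb.le
    have hSS : S ^ 2 ≤ n ^ 2 := pow_le_pow_left₀ hS0 hS 2
    have haS : a * S ^ 2 ≤ a * n ^ 2 := mul_le_mul_of_nonneg_left hSS ha0.le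
    refine ⟨by linarith, fun he => Or.inr ?_⟩
    have : S ^ 2 = n ^ 2 := mul_left_cancel₀ ha0.ne' (by linarith : a * S ^ 2 = a * n ^ 2)
    exact (pow_left_inj₀ hS0 hn two_ne_zero).1 this
  · rw [not_lt] at ha0
    have hq1' : 1 < q := by
      rcases eq_or_lt_of_le hq1 with e | e
      · rw [← e] at hab; linarith
      · exact e
    refine ⟨?_, fun _ => Or.inl hq1'⟩
    have h2 : -a * (q / (2 * q - 2)) * 2 ≤ b := by
      rw [mul_div_assoc', div_mul_eq_mul_div, div_le_iff₀ (by linarith)]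
      linarith
    have h3 : -a * (n - S) ≤ b / 2 * (n - X) := by
      have i1 := mul_le_mul_of_nonneg_left (h hq1') (neg_nonneg.2 ha0)
      have i2 := mul_le_mul_of_nonneg_right h2 (sub_nonneg.2 hX)
      linarith
    have h4 := mul_le_mul_of_nonneg_left h3 hn
    have h5 := mul_nonneg (neg_nonneg.2 ha0) (sq_nonneg (n - S))
    linarith

/-- The total energy bound, and the information contained in the case of equality, for `2 ≤ d`. -/
lemma energy_le_of_two_le (h : FrameNumbers d m r s) (hd : 2 ≤ d) (hm : m = 1 ∨ m = 2 ∨ m = 4)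
    (hB : B = 1 / (d + 2 / m)) (hq1 : 1 ≤ q) (hq2 : q < 2) :
    ∑ i, ∑ j, s i j ^ q - ∑ i, r i ^ (2 * q) ≤ N ^ 2 * momentBound d (2 / m) (q / 2) B - N ∧
    (∑ i, ∑ j, s i j ^ q - ∑ i, r i ^ (2 * q) = N ^ 2 * momentBound d (2 / m) (q / 2) B - N →
      (∀ i, r i = 1) ∧ ∀ i j, s i j ^ 2 = B ∨ s i j ^ 2 = 1) := by
  have hd2 : (2 : ℝ) ≤ d := by exact_mod_cast hd
  have hμ : 0 < 2 / m := by rcases hm with rfl | rfl | rfl <;> norm_num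
  have hq0 : 0 < q := by linarith
  have hB0 : 0 < B := by rw [hB]; positivity
  have hB1 : B < 1 := by rw [hB, div_lt_one (by positivity)]; linarith
  have hlt := hermiteSlope_div_lt hd hm hB hq1 hq2
  have hmom := hermite_moments (p := q / 2) (by linarith : (1 : ℝ) ≤ d) hμ hB
  have hb : 0 < hermiteSlope (q / 2) B / d :=
    div_pos (hermiteSlope_pos (by linarith) (by linarith) hB0 hB1) (by linarith)
  have hmaj := h.majorant_le hq0 hq2 hB0 hB1
  set H := momentBound d (2 / m) (q / 2) B with hH
  set b := hermiteSlope (q / 2) B / d with hbdef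
  set a := hermiteQuad (q / 2) B 0 + hermiteCoeff (q / 2) B * ((1 + 2 / m) / (d * (d + 2 / m)))
    with ha
  have haH : a + b = H := by rw [← hmom, ha]; ring
  set S := ∑ i, r i ^ q with hS
  set X := ∑ j, r j ^ (2 * q - 2) with hX
  have hsum : ∑ i, r i ^ 2 = (Fintype.card (Fin N) : ℝ) := by rw [h.sum_sq]; simp
  have hSN : S ≤ N := by simpa using sum_rpow_le_card h.r_nonneg hsum hq0.le hq2.le
  have hXN : X ≤ N := by
    simpa using sum_rpow_le_card h.r_nonneg hsum (by linarith : 0 ≤ 2 * q - 2) (by linarith)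
  have hRN : (N : ℝ) ≤ ∑ i, r i ^ (2 * q) := by simpa using card_le_sum_rpow h.r_nonneg hsum hq1
  have hS0 : 0 ≤ S := Finset.sum_nonneg fun i _ => Real.rpow_nonneg (h.r_nonneg i) _
  have hN0 : (0 : ℝ) ≤ N := Nat.cast_nonneg N
  have hpt : ∀ i j, s i j ^ q ≤ r i ^ q * r j ^ q * hermiteQuad (q / 2) B (cosSq r s i j) := by
    intro i j
    rw [h.rpow_eq hq0]
    exact mul_le_mul_of_nonneg_left (rpow_le_hermiteQuad (by linarith) (by linarith) hB0 hB1
      (cosSq_nonneg i j) (h.cosSq_le_one i j)) (mul_nonneg (Real.rpow_nonneg (h.r_nonneg i) _)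
      (Real.rpow_nonneg (h.r_nonneg j) _))
  have hT : ∑ i, ∑ j, s i j ^ q ≤ majorant q B r s :=
    Finset.sum_le_sum fun i _ => Finset.sum_le_sum fun j _ => hpt i j
  have hfin : a * S ^ 2 + b * (N * X) ≤ N ^ 2 * H ∧
      (a * S ^ 2 + b * (N * X) = N ^ 2 * H → 1 < q ∨ S = N) := by
    refine haH ▸ add_mul_le_of_power_sums hq1 hb (haH.symm ▸ hlt) hN0 hS0 hSN hXN fun hq => ?_
    simpa using card_sub_sum_rpow_le h.r_nonneg hq hq2.le
  refine ⟨by linarith [hfin.1], fun he => ?_⟩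
  have hR : ∑ i, r i ^ (2 * q) = N := by linarith [hfin.1]
  have hr1 : ∀ i, r i = 1 := by
    -- For `1 < q` the diagonal sum forces unit lengths. At `q = 1` it is identically `N`, so `S =
    -- N` is used instead.
    rcases hfin.2 (by linarith [hfin.1]) with h1 | h1
    · exact eq_one_of_card_eq_sum_rpow h.r_nonneg hsum h1 (by simpa using hR)
    · exact eq_one_of_sum_rpow_eq_card h.r_nonneg hsum hq0 hq2 (by simpa using h1)
  refine ⟨hr1, fun i j => ?_⟩
  have hTe : ∑ i, ∑ j, s i j ^ q = majorant q B r s := by linarith [hfin.1]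
  have hrow := (Finset.sum_eq_sum_iff_of_le fun i _ =>
    Finset.sum_le_sum fun j _ => hpt i j).1 hTe i (Finset.mem_univ i)
  have hent := (Finset.sum_eq_sum_iff_of_le fun j _ => hpt i j).1 hrow j (Finset.mem_univ j)
  have hc : cosSq r s i j = s i j ^ 2 := by simp [cosSq, hr1]
  rw [h.rpow_eq hq0, hr1, hr1, Real.one_rpow, one_mul, one_mul, one_mul] at hent
  by_contra! hcon
  refine (rpow_lt_hermiteQuad (p := q / 2) (by linarith) (by linarith) hB0 hB1
    (cosSq_nonneg i j) (h.cosSq_le_one i j) ?_ ?_).ne hent <;> rw [hc]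
  exacts [hcon.1, hcon.2]

lemma energy_le_of_lt_two (h : FrameNumbers d m r s) (hd : 1 ≤ d) (hm : m = 1 ∨ m = 2 ∨ m = 4)
    (hB : B = 1 / (d + 2 / m)) (hq1 : 1 ≤ q) (hq2 : q < 2) :
    ∑ i, ∑ j, s i j ^ q - ∑ i, r i ^ (2 * q) ≤ N ^ 2 * momentBound d (2 / m) (q / 2) B - N ∧
    (∑ i, ∑ j, s i j ^ q - ∑ i, r i ^ (2 * q) = N ^ 2 * momentBound d (2 / m) (q / 2) B - N →
      (∀ i, r i = 1) ∧ ∀ i j, s i j ^ 2 = B ∨ s i j ^ 2 = 1) := by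
  rcases Nat.lt_or_ge 1 d with h2 | h2
  · exact h.energy_le_of_two_le h2 hm hB hq1 hq2
  obtain rfl : d = 1 := le_antisymm h2 hd
  have hq0 : 0 < q := by linarith
  have hsum : ∑ i, r i ^ 2 = (Fintype.card (Fin N) : ℝ) := by rw [h.sum_sq]; simp
  have hSN : ∑ i, r i ^ q ≤ (N : ℝ) := by
    simpa using sum_rpow_le_card h.r_nonneg hsum hq0.le hq2.le
  have hRN : (N : ℝ) ≤ ∑ i, r i ^ (2 * q) := by simpa using card_le_sum_rpow h.r_nonneg hsum hq1
  have hS0 : 0 ≤ ∑ i, r i ^ q := Finset.sum_nonneg fun i _ => Real.rpow_nonneg (h.r_nonneg i) _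
  have hT : ∑ i, ∑ j, s i j ^ q = (∑ i, r i ^ q) ^ 2 := by
    rw [sq, Finset.sum_mul_sum]
    refine Finset.sum_congr rfl fun i _ => Finset.sum_congr rfl fun j _ => ?_
    rw [h.rank_one rfl, Real.mul_rpow (h.r_nonneg i) (h.r_nonneg j)]
  have hH : momentBound (1 : ℕ) (2 / m) (q / 2) B = 1 := by simp [momentBound]
  rw [hT, hH]
  have hSS : (∑ i, r i ^ q) ^ 2 ≤ (N : ℝ) ^ 2 := pow_le_pow_left₀ hS0 hSN 2
  refine ⟨by linarith, fun he => ?_⟩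
  have hS : ∑ i, r i ^ q = (N : ℝ) :=
    (pow_left_inj₀ hS0 (Nat.cast_nonneg N) two_ne_zero).1 (by linarith)
  have hr1 := eq_one_of_sum_rpow_eq_card h.r_nonneg hsum hq0 hq2 (by simpa using hS)
  exact ⟨hr1, fun i j => Or.inr (by rw [h.rank_one rfl, hr1, hr1]; norm_num)⟩

lemma energy_two_le (h : FrameNumbers d m r s) (hd : 1 ≤ d) (hm : 0 < m)
    (hB : B = 1 / (d + 2 / m)) :
    ∑ i, ∑ j, s i j ^ (2 : ℝ) - ∑ i, r i ^ (2 * 2 : ℝ) ≤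
      N ^ 2 * momentBound d (2 / m) (2 / 2) B - N := by
  have hd1 : (1 : ℝ) ≤ d := by exact_mod_cast hd
  have hμ : 0 < 2 / m := by positivity
  have hsum : ∑ i, r i ^ 2 = (Fintype.card (Fin N) : ℝ) := by rw [h.sum_sq]; simp
  have hRN := card_le_sum_rpow h.r_nonneg hsum (by norm_num : (1 : ℝ) ≤ 2)
  rw [Fintype.card_fin] at hRN
  -- At `q = 2` tightness gives the full sum exactly; only the diagonal is estimated.
  have hT : ∑ i, ∑ j, s i j ^ (2 : ℝ) = N ^ 2 / d := by
    simp only [Real.rpow_two, h.tight', ← Finset.mul_sum, h.sum_sq]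
    ring
  have hH : momentBound d (2 / m) (2 / 2) B = 1 / d := by
    generalize 2 / m = μ at *
    have h1 : (d : ℝ) + μ - 1 ≠ 0 := by linarith
    have h2 : (d : ℝ) + μ ≠ 0 := by linarith
    have h3 : (d : ℝ) ≠ 0 := by linarith
    have h5 : (d : ℝ) + ((d : ℝ) ^ 2 - d) / μ = d * (d + μ - 1) / μ := by field_simp; ring
    rw [momentBound, div_self two_ne_zero, Real.rpow_one, h5, hB]
    field_simp
  rw [hT, hH, mul_one_div]
  exact sub_le_sub_left hRN _

end FrameNumbers

end EnergyOfNumbers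

open ProjFrame

/-! ### Cauchy-Schwarz lower bound for fourth moments. -/

section DesignInequality

/-- A lower bound for the fourth moment of vectors `X i` in a real inner product space of dimension
`|κ|` that contains a vector `e` with `⟨e, e⟩ = d`, `⟨e, X i⟩ = ρ i` and `⟨X i, X i⟩ = ρ i ^ 2`. -/
lemma sq_sum_mul_le_sum_sq {ι κ : Type*} [Fintype ι] [Fintype κ] [DecidableEq κ] (X : ι → κ → ℝ)
    (e : κ → ℝ) (ρ : ι → ℝ) (d μ : ℝ) (hee : ∑ a, e a * e a = d) (heX : ∀ i, ∑ a, e a * X i a = ρ i)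
    (hXX : ∀ i, ∑ a, X i a * X i a = ρ i ^ 2) :
    ((1 + μ) * ∑ i, ρ i ^ 2) ^ 2 ≤ (μ ^ 2 * Fintype.card κ + 2 * μ * d + d ^ 2) *
      ∑ i, ∑ j, (∑ a, X i a * X j a) ^ 2 := by
  -- Cauchy-Schwarz is applied to the matrices ∑ X_i X_iᵀ and μ I + e eᵀ; the three sums are their
  -- inner product and squared norms.
  have hTD : ∑ p : κ × κ, (μ * (if p.1 = p.2 then 1 else 0) + e p.1 * e p.2) *
      ∑ i, X i p.1 * X i p.2 = (1 + μ) * ∑ i, ρ i ^ 2 := by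
    simp only [Finset.mul_sum]
    rw [Finset.sum_comm]
    refine Finset.sum_congr rfl fun i _ => ?_
    have : ∑ p : κ × κ, (μ * (if p.1 = p.2 then 1 else 0) + e p.1 * e p.2) * (X i p.1 * X i p.2) =
        μ * ∑ a, X i a * X i a + (∑ a, e a * X i a) * ∑ a, e a * X i a := by
      rw [Finset.sum_mul_sum, Fintype.sum_prod_type, Finset.mul_sum, ← Finset.sum_add_distrib]
      refine Finset.sum_congr rfl fun a _ => ?_
      simp only [add_mul, Finset.sum_add_distrib]
      congr 1
      · simp
      · exact Finset.sum_congr rfl fun b _ => by ring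
    rw [this, hXX, heX]
    ring
  have hDD : ∑ p : κ × κ, (μ * (if p.1 = p.2 then 1 else 0) + e p.1 * e p.2) ^ 2 =
      μ ^ 2 * Fintype.card κ + 2 * μ * d + d ^ 2 := by
    have : ∑ p : κ × κ, (μ * (if p.1 = p.2 then 1 else 0) + e p.1 * e p.2) ^ 2 =
        ∑ a : κ, μ ^ 2 + 2 * μ * (∑ a, e a * e a) + (∑ a, e a * e a) * ∑ a, e a * e a := by
      rw [Finset.sum_mul_sum, Fintype.sum_prod_type, Finset.mul_sum, ← Finset.sum_add_distrib,
        ← Finset.sum_add_distrib]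
      refine Finset.sum_congr rfl fun a _ => ?_
      have : ∀ b, (μ * (if a = b then 1 else 0) + e a * e b) ^ 2 =
          (if a = b then μ ^ 2 + 2 * μ * (e a * e b) else 0) + e a * e a * (e b * e b) := by
        intro b; split_ifs <;> ring
      simp only [this, Finset.sum_add_distrib]
      simp
    rw [this, hee]
    simp
    ring
  have hTT : ∑ p : κ × κ, (∑ i, X i p.1 * X i p.2) ^ 2 =
      ∑ i, ∑ j, (∑ a, X i a * X j a) ^ 2 := by
    have e1 : ∀ p : κ × κ, (∑ i, X i p.1 * X i p.2) ^ 2 =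
        ∑ i, ∑ j, (X i p.1 * X j p.1) * (X i p.2 * X j p.2) := fun p => by
      rw [sq, Finset.sum_mul_sum]
      exact Finset.sum_congr rfl fun i _ => Finset.sum_congr rfl fun j _ => by ring
    simp only [e1]
    rw [Finset.sum_comm]
    refine Finset.sum_congr rfl fun i _ => ?_
    rw [Finset.sum_comm]
    refine Finset.sum_congr rfl fun j _ => ?_
    rw [Fintype.sum_prod_type, sq, Finset.sum_mul_sum]
  have := Finset.sum_mul_sq_le_sq_mul_sq Finset.univ
    (fun p : κ × κ => μ * (if p.1 = p.2 then 1 else 0) + e p.1 * e p.2)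
    (fun p : κ × κ => ∑ i, X i p.1 * X i p.2)
  rwa [hTD, hDD, hTT] at this

lemma sum_sum_eq_diag_add {d : ℕ} (f : Fin d → Fin d → ℝ) (hf : ∀ k l, f k l = f l k) :
    ∑ k, ∑ l, f k l = ∑ k, f k k + 2 * ∑ p : {p : Fin d × Fin d // p.1 < p.2}, f p.1.1 p.1.2 := by
  have h1 : ∑ p : {p : Fin d × Fin d // p.1 < p.2}, f p.1.1 p.1.2 =
      ∑ k, ∑ l, if k < l then f k l else 0 := by
    rw [← Fintype.sum_prod_type' (f := fun k l => if k < l then f k l else 0),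
      ← Finset.sum_filter]
    exact (Finset.sum_subtype (Finset.univ.filter fun p : Fin d × Fin d => p.1 < p.2)
      (by simp) (fun p => f p.1 p.2)).symm
  have h2 : ∑ k, ∑ l, (if l < k then f k l else 0) = ∑ k, ∑ l, if k < l then f k l else 0 := by
    rw [Finset.sum_comm]
    exact Finset.sum_congr rfl fun k _ => Finset.sum_congr rfl fun l _ => by rw [hf]
  have h3 : ∀ k l, f k l = (if k = l then f k l else 0) + (if k < l then f k l else 0) +
      (if l < k then f k l else 0) := by
    intro k l
    rcases lt_trichotomy k l with h | h | h
    · simp [h, h.ne, h.le]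
    · simp [h]
    · simp [h, h.ne', h.le]
  rw [Finset.sum_congr rfl fun k _ => Finset.sum_congr rfl fun l _ => h3 k l]
  simp only [Finset.sum_add_distrib]
  rw [h2, h1]
  simp
  ring

lemma card_pairs_lt (d : ℕ) :
    (Fintype.card {p : Fin d × Fin d // p.1 < p.2} : ℝ) = ((d : ℝ) ^ 2 - d) / 2 := by
  have := sum_sum_eq_diag_add (d := d) (fun _ _ => 1) (fun _ _ => rfl)
  simp at this
  linarith

end DesignInequality

/-! ### Hermitian geometry over ℝ, ℂ and ℍ through real coordinates. -/

section Coordinates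

variable {K : Type} [NormedDivisionRing K] {n : ℕ}

/-- The real bilinear form `∑ k, c k a * c k b` attached to real coordinates on `K`. -/
def coordForm (c : Fin n → K →+ ℝ) (a b : K) : ℝ := ∑ k, c k a * c k b

lemma coordForm_comm (c : Fin n → K →+ ℝ) (a b : K) : coordForm c a b = coordForm c b a :=
  Finset.sum_congr rfl fun _ _ => mul_comm _ _

lemma coordForm_sum_left {ι : Type*} (s : Finset ι) (c : Fin n → K →+ ℝ) (f : ι → K) (b : K) :
    coordForm c (∑ i ∈ s, f i) b = ∑ i ∈ s, coordForm c (f i) b := by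
  simp only [coordForm, map_sum, Finset.sum_mul]
  exact Finset.sum_comm

lemma coordForm_sum_right {ι : Type*} (s : Finset ι) (c : Fin n → K →+ ℝ) (f : ι → K) (b : K) :
    coordForm c b (∑ i ∈ s, f i) = ∑ i ∈ s, coordForm c b (f i) := by
  simp only [coordForm_comm c b, coordForm_sum_left]

lemma coordForm_sub_sub (c : Fin n → K →+ ℝ) (a b : K) :
    coordForm c (a - b) (a - b) = coordForm c a a - 2 * coordForm c a b + coordForm c b b := by
  simp only [coordForm, map_sub, Finset.mul_sum, ← Finset.sum_sub_distrib, ← Finset.sum_add_distrib]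
  exact Finset.sum_congr rfl fun _ _ => by ring

lemma vec_norm_sq {d : ℕ} (x : Vec K d) : ‖x‖ ^ 2 = ∑ k, ‖x k‖ ^ 2 :=
  PiLp.norm_sq_eq_of_L2 _ x

variable [StarRing K]

/-- Real coordinates on `K` whose standard form induces the norm, such that multiplication by
`star a` is adjoint to multiplication by `a`. -/
structure IsHermitianCoords (c : Fin n → K →+ ℝ) : Prop where
  self : ∀ a, coordForm c a a = ‖a‖ ^ 2
  mul_left : ∀ a b e, coordForm c (a * b) e = coordForm c b (star a * e)
  mul_right : ∀ a b e, coordForm c (a * b) e = coordForm c a (e * star b)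

namespace IsHermitianCoords

variable {c : Fin n → K →+ ℝ} (hc : IsHermitianCoords c) {d : ℕ}
include hc

lemma star_star (a b : K) : coordForm c (star a) (star b) = coordForm c a b := by
  have h1 := hc.mul_left (star a) 1 (star b)
  have h2 := hc.mul_right 1 b a
  rw [mul_one, _root_.star_star] at h1
  rw [one_mul] at h2
  rw [h1, ← h2, coordForm_comm]

lemma norm_star (a : K) : ‖star a‖ = ‖a‖ := by
  have h : ‖star a‖ ^ 2 = ‖a‖ ^ 2 := by rw [← hc.self, ← hc.self, hc.star_star]
  exact (pow_left_inj₀ (norm_nonneg _) (norm_nonneg _) two_ne_zero).1 h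

/-- The right side is the real inner product of the matrices x x^* and y y^*. The adjointness rules
move factors without commuting them. -/
lemma norm_herm_sq (x y : Vec K d) : ‖herm x y‖ ^ 2 =
    ∑ k, ∑ l, coordForm c (x k * star (x l)) (y k * star (y l)) := by
  rw [← hc.self, herm, coordForm_sum_left]
  refine Finset.sum_congr rfl fun k _ => ?_
  rw [coordForm_sum_right]
  refine Finset.sum_congr rfl fun l _ => ?_
  rw [hc.mul_left, _root_.star_star, ← mul_assoc, coordForm_comm, hc.mul_right]

lemma diag (a b : K) : coordForm c (a * star a) (b * star b) = ‖a‖ ^ 2 * ‖b‖ ^ 2 := by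
  rw [hc.mul_right, _root_.star_star, coordForm_comm, mul_assoc, hc.mul_left, hc.self, norm_mul,
    hc.norm_star]
  ring

lemma norm_herm_self (x : Vec K d) : ‖herm x x‖ = ‖x‖ ^ 2 := by
  have h : ‖herm x x‖ ^ 2 = (‖x‖ ^ 2) ^ 2 := by
    rw [hc.norm_herm_sq, vec_norm_sq, sq (∑ k, ‖x k‖ ^ 2), Finset.sum_mul_sum]
    refine Finset.sum_congr rfl fun k _ => Finset.sum_congr rfl fun l _ => ?_
    rw [hc.self, norm_mul, hc.norm_star]
    ring
  exact (pow_left_inj₀ (norm_nonneg _) (by positivity) two_ne_zero).1 h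

lemma norm_herm_comm (x y : Vec K d) : ‖herm x y‖ = ‖herm y x‖ := by
  rw [← hc.norm_star]
  congr 1
  simp [herm]

lemma norm_herm_le (x y : Vec K d) : ‖herm x y‖ ≤ ‖x‖ * ‖y‖ := by
  refine (norm_sum_le _ _).trans ?_
  simp only [norm_mul, hc.norm_star]
  refine abs_le_of_sq_le_sq' ?_ (by positivity) |>.2
  rw [mul_pow, vec_norm_sq, vec_norm_sq]
  exact Finset.sum_mul_sq_le_sq_mul_sq _ _ _

/-- The case of equality in the Cauchy-Schwarz inequality for unit vectors. -/
lemma eq_mul_herm {u v : Vec K d} (hu : ‖u‖ = 1) (hv : ‖v‖ = 1) (h : ‖herm u v‖ = 1) (k : Fin d) :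
    v k = u k * herm u v := by
  set e := herm u v with he
  -- The sum expands to 1 - 2|e|² + |e|², which is 0 as |e| = 1.
  have hsum : ∑ k, ‖v k - u k * e‖ ^ 2 = 0 := by
    have h1 : ∀ k, ‖v k - u k * e‖ ^ 2 =
        ‖v k‖ ^ 2 - 2 * coordForm c (star (u k) * v k) e + ‖u k‖ ^ 2 := by
      intro k
      rw [← hc.self, coordForm_sub_sub, hc.self, hc.self, norm_mul, h, hc.mul_left,
        _root_.star_star, mul_one]
    simp only [h1, Finset.sum_add_distrib, Finset.sum_sub_distrib, ← Finset.mul_sum]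
    rw [← vec_norm_sq, ← vec_norm_sq, ← coordForm_sum_left, hu, hv]
    change 1 ^ 2 - 2 * coordForm c e e + 1 ^ 2 = 0
    rw [hc.self, h]
    norm_num
  have := (Finset.sum_eq_zero_iff_of_nonneg fun k _ => by positivity).1 hsum k (Finset.mem_univ k)
  exact sub_eq_zero.1 (norm_eq_zero.1 (pow_eq_zero_iff two_ne_zero |>.1 this))

/-- The fourth moment inequality for vectors in `K ^ d`. -/
lemma design_le {N : ℕ} (hd : 1 ≤ d) (hn : 1 ≤ n) (y : Fin N → Vec K d) (w : Fin N → ℝ) :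
    (1 + 2 / n) / (d * (d + 2 / n)) * (∑ i, (w i * ‖y i‖ ^ 2) ^ 2) ^ 2 ≤
      ∑ i, ∑ j, (w i * w j * ‖herm (y i) (y j)‖ ^ 2) ^ 2 := by
  have hd1 : (1 : ℝ) ≤ d := by exact_mod_cast hd
  have hn1 : (1 : ℝ) ≤ n := by exact_mod_cast hn
  -- `Φ x` lists the coordinates of x x^* in the M-dimensional real space of Hermitian matrices: the
  -- diagonal, and the upper entries scaled by √2 since each occurs twice. The vector `e` is the
  -- identity matrix.
  obtain ⟨Φ, hΦ⟩ : ∃ Φ : Vec K d → Fin d ⊕ ({p : Fin d × Fin d // p.1 < p.2} × Fin n) → ℝ,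
      Φ = fun x => Sum.elim (fun k => ‖x k‖ ^ 2)
        (fun p => √2 * c p.2 (x p.1.1.1 * star (x p.1.1.2))) := ⟨_, rfl⟩
  obtain ⟨e, he⟩ : ∃ e : Fin d ⊕ ({p : Fin d × Fin d // p.1 < p.2} × Fin n) → ℝ,
      e = Sum.elim (fun _ => 1) (fun _ => 0) := ⟨_, rfl⟩
  have hΦΦ : ∀ x z, ∑ a, Φ x a * Φ z a = ‖herm x z‖ ^ 2 := by
    intro x z
    rw [hc.norm_herm_sq, sum_sum_eq_diag_add]
    · rw [Fintype.sum_sum_type, Fintype.sum_prod_type, Finset.mul_sum, hΦ]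
      congr 1
      · exact Finset.sum_congr rfl fun k _ => by simp [hc.diag]
      · refine Finset.sum_congr rfl fun p _ => ?_
        rw [coordForm, Finset.mul_sum]
        refine Finset.sum_congr rfl fun k _ => ?_
        simp only [Sum.elim_inr]
        rw [mul_mul_mul_comm, Real.mul_self_sqrt zero_le_two]
    · intro k l
      rw [← hc.star_star]
      simp
  have heΦ : ∀ x, ∑ a, e a * Φ x a = ‖x‖ ^ 2 := by
    intro x
    rw [Fintype.sum_sum_type, he, hΦ, vec_norm_sq]
    simp
  have hee : ∑ a, e a * e a = d := by
    rw [Fintype.sum_sum_type, he]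
    simp
  have key := sq_sum_mul_le_sum_sq (fun i a => w i * Φ (y i) a) e (fun i => w i * ‖y i‖ ^ 2) d
    (2 / n) hee
    (fun i => by rw [← heΦ, Finset.mul_sum]; exact Finset.sum_congr rfl fun _ _ => by ring)
    (fun i => by
      rw [mul_pow, ← hc.norm_herm_self, ← hΦΦ, Finset.mul_sum]
      exact Finset.sum_congr rfl fun _ _ => by ring)
  have hin : ∀ i j, ∑ a, w i * Φ (y i) a * (w j * Φ (y j) a) =
      w i * w j * ‖herm (y i) (y j)‖ ^ 2 := by
    intro i j
    rw [← hΦΦ, Finset.mul_sum]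
    exact Finset.sum_congr rfl fun _ _ => by ring
  simp only [hin] at key
  have hcard : (Fintype.card (Fin d ⊕ ({p : Fin d × Fin d // p.1 < p.2} × Fin n)) : ℝ) =
      d + ((d : ℝ) ^ 2 - d) / 2 * n := by
    rw [Fintype.card_sum, Fintype.card_prod, Nat.cast_add, Nat.cast_mul, card_pairs_lt]
    simp
  rw [hcard] at key
  have hμ : (0 : ℝ) < 2 / n := by positivity
  have hD : (2 / n : ℝ) ^ 2 * (d + ((d : ℝ) ^ 2 - d) / 2 * n) + 2 * (2 / n) * d + (d : ℝ) ^ 2 =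
      d * (d + 2 / n) * (1 + 2 / n) := by
    field_simp
    ring
  rw [hD] at key
  have hpos : 0 < (d : ℝ) * (d + 2 / n) * (1 + 2 / n) := by positivity
  calc _ = ((1 + 2 / n) * ∑ i, (w i * ‖y i‖ ^ 2) ^ 2) ^ 2 / (d * (d + 2 / n) * (1 + 2 / n)) := by
        have : (1 + 2 / n : ℝ) ≠ 0 := by positivity
        have : (d + 2 / n : ℝ) ≠ 0 := by positivity
        generalize (2 / n : ℝ) = μ at *
        field_simp
    _ ≤ _ := by
        rw [div_le_iff₀ hpos]
        linarith

lemma frameNumbers {N : ℕ} (hd : 1 ≤ d) (hn : 1 ≤ n) (y : Fin N → Vec K d)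
    (hy : IsTightFrame ((N : ℝ) / d) y) :
    FrameNumbers d n (fun i => ‖y i‖) (fun i j => ‖herm (y i) (y j)‖) where
  r_nonneg _ := norm_nonneg _
  s_nonneg _ _ := norm_nonneg _
  s_le _ _ := hc.norm_herm_le _ _
  s_self _ := hc.norm_herm_self _
  sum_sq := by
    have hd0 : (d : ℝ) ≠ 0 := by positivity
    -- The frame identity is tested on the standard basis vectors.
    have h1 : ∀ k : Fin d, ∑ i, ‖y i k‖ ^ 2 = (N : ℝ) / d := by
      intro k
      have h := hy (WithLp.toLp 2 (Pi.single k 1))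
      have e1 : ‖(WithLp.toLp 2 (Pi.single k 1) : Vec K d)‖ ^ 2 = 1 := by
        rw [vec_norm_sq, Finset.sum_eq_single k]
        · simp
        · intro l _ hl; simp [hl]
        · simp
      have e2 : ∀ v : Vec K d, herm (WithLp.toLp 2 (Pi.single k 1)) v = v k := by
        intro v
        rw [herm, Finset.sum_eq_single k]
        · simp
        · intro l _ hl; simp [hl]
        · simp
      simpa only [e1, e2, mul_one] using h
    simp only [vec_norm_sq]
    rw [Finset.sum_comm]
    simp only [h1]
    simp
    field_simp
  tight j := by
    simp only [hc.norm_herm_comm _ (y j)]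
    exact hy (y j)
  tight' i := hy (y i)
  design := hc.design_le hd hn y
  rank_one h i j := by
    subst h
    have e : ∀ v : Vec K 1, ‖v‖ = ‖v 0‖ := fun v =>
      (pow_left_inj₀ (norm_nonneg _) (norm_nonneg _) two_ne_zero).1 (by simp [vec_norm_sq])
    simp [herm, hc.norm_star, e]

end IsHermitianCoords

end Coordinates

/-! ### Unit representatives of projective points. -/

section ProjectivePoints

variable {K : Type} [NormedDivisionRing K] {d : ℕ}

lemma ProjFrame.IsUnitRep.exists_mul {u v : Vec K d} {p : ProjSpace K d} (hu : IsUnitRep u p)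
    (hv : IsUnitRep v p) : ∃ e : K, ‖e‖ = 1 ∧ ∀ k, v k = u k * e := by
  obtain ⟨hu1, hu0, hup⟩ := hu
  obtain ⟨hv1, hv0, hvp⟩ := hv
  obtain ⟨a, ha⟩ := (Projectivization.mk_eq_mk_iff' Kᵐᵒᵖ v u hv0 hu0).1 (hvp.trans hup.symm)
  have hk : ∀ k, v k = u k * a.unop := fun k => by rw [← ha]; rfl
  refine ⟨a.unop, ?_, hk⟩
  have h : ‖v‖ ^ 2 = ‖u‖ ^ 2 * ‖a.unop‖ ^ 2 := by
    rw [vec_norm_sq, vec_norm_sq, Finset.sum_mul]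
    exact Finset.sum_congr rfl fun k _ => by rw [hk, norm_mul, mul_pow]
  rw [hu1, hv1] at h
  exact (pow_eq_one_iff_of_nonneg (norm_nonneg _) two_ne_zero).1 (by linarith)

variable [StarRing K]

lemma norm_herm_eq_of_isUnitRep_right {u u' v : Vec K d} {p : ProjSpace K d} (hu : IsUnitRep u p)
    (hu' : IsUnitRep u' p) : ‖herm v u‖ = ‖herm v u'‖ := by
  obtain ⟨e, he, hk⟩ := hu'.exists_mul hu
  have : herm v u = herm v u' * e := by
    rw [herm, herm, Finset.sum_mul]
    exact Finset.sum_congr rfl fun k _ => by rw [hk, mul_assoc]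
  rw [this, norm_mul, he, mul_one]

variable {n : ℕ} {c : Fin n → K →+ ℝ} (hc : IsHermitianCoords c)
include hc

namespace IsHermitianCoords

lemma norm_herm_eq_of_isUnitRep {u u' v v' : Vec K d} {p p' : ProjSpace K d} (hu : IsUnitRep u p)
    (hu' : IsUnitRep u' p) (hv : IsUnitRep v p') (hv' : IsUnitRep v' p') :
    ‖herm u v‖ = ‖herm u' v'‖ := by
  rw [norm_herm_eq_of_isUnitRep_right hv hv', hc.norm_herm_comm,
    norm_herm_eq_of_isUnitRep_right hu hu', hc.norm_herm_comm]

lemma norm_herm_eq_one_of_isUnitRep {u v : Vec K d} {p : ProjSpace K d} (hu : IsUnitRep u p)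
    (hv : IsUnitRep v p) : ‖herm u v‖ = 1 := by
  rw [hc.norm_herm_eq_of_isUnitRep hu hu hv hu, hc.norm_herm_self, hu.1, one_pow]

lemma mk_eq_mk_of_norm_herm {u v : Vec K d} (hu : ‖u‖ = 1) (hv : ‖v‖ = 1) (hu0 : u ≠ 0)
    (hv0 : v ≠ 0) (h : ‖herm u v‖ = 1) :
    Projectivization.mk Kᵐᵒᵖ u hu0 = Projectivization.mk Kᵐᵒᵖ v hv0 := by
  refine ((Projectivization.mk_eq_mk_iff' Kᵐᵒᵖ v u hv0 hu0).2
    ⟨MulOpposite.op (herm u v), ?_⟩).symm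
  ext k
  exact (hc.eq_mul_herm hu hv h k).symm

end IsHermitianCoords

end ProjectivePoints

/-! ### Multiplicities and the number of points. -/

section Counting

/-- Row sums of a two-valued matrix that distinguishes equal from different labels. -/
lemma card_filter_mul_eq {ι α : Type*} [Fintype ι] [DecidableEq α] (P : ι → α) (f : ι → ι → ℝ)
    {τ A : ℝ} (h1 : ∀ i j, P i = P j → f i j = 1) (h2 : ∀ i j, P i ≠ P j → f i j = τ)
    (hrow : ∀ i, ∑ j, f i j = A) (i : ι) :
    ((Finset.univ.filter fun j => P j = P i).card : ℝ) * (1 - τ) = A - τ * Fintype.card ι := by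
  have : ∀ j, f i j = τ + (if P j = P i then 1 - τ else 0) := by
    intro j
    split_ifs with h
    · rw [h1 i j h.symm]; ring
    · rw [h2 i j (Ne.symm h)]; ring
  rw [← hrow i]
  simp only [this, Finset.sum_add_distrib]
  rw [← Finset.sum_filter]
  simp
  ring

/-- The row sums give all fibres of `P` the same size; adding these sizes over `S` counts the
indices. -/
lemma card_mul_eq {ι α : Type*} [Fintype ι] [DecidableEq α] (P : ι → α) (f : ι → ι → ℝ)
    (S : Finset α) {τ A : ℝ} (hPS : ∀ i, P i ∈ S) (hSP : ∀ p ∈ S, ∃ i, P i = p)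
    (h1 : ∀ i j, P i = P j → f i j = 1) (h2 : ∀ i j, P i ≠ P j → f i j = τ)
    (hrow : ∀ i, ∑ j, f i j = A) :
    (Fintype.card ι : ℝ) * (1 - τ) = S.card * (A - τ * Fintype.card ι) := by
  have hcard := Finset.card_eq_sum_card_fiberwise (s := Finset.univ) (t := S) (f := P)
    (fun i _ => hPS i)
  have hcard' : (Fintype.card ι : ℝ) =
      ∑ p ∈ S, ((Finset.univ.filter fun j => P j = p).card : ℝ) := by
    rw [← Finset.card_univ, hcard, Nat.cast_sum]
  have hp : ∀ p ∈ S, ((Finset.univ.filter fun j => P j = p).card : ℝ) * (1 - τ) =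
      A - τ * Fintype.card ι := by
    intro p hp
    obtain ⟨i, rfl⟩ := hSP p hp
    exact card_filter_mul_eq P f h1 h2 hrow i
  have : (∑ p ∈ S, ((Finset.univ.filter fun j => P j = p).card : ℝ)) * (1 - τ) =
      S.card * (A - τ * Fintype.card ι) := by
    rw [Finset.sum_mul, Finset.sum_congr rfl hp, Finset.sum_const, nsmul_eq_mul]
  rwa [← hcard'] at this

/-- Equivalently, mass 1/M at 1 and the remaining mass at B have mean 1/d. -/
lemma simplexSize_relation {d μ B : ℝ} (hd : 1 ≤ d) (hμ : 0 < μ) (hB : B = 1 / (d + μ)) :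
    (d + (d ^ 2 - d) / μ) * (1 / d - B) = 1 - B := by
  have h2 : d + μ ≠ 0 := by linarith
  have h3 : d ≠ 0 := by linarith
  rw [hB]
  field_simp
  ring

end Counting

/-! ### The equality case and the theorem for the three choices of K. -/

section Main

variable {K : Type} [NormedDivisionRing K] [StarRing K] {n d N : ℕ}

namespace IsHermitianCoords

variable {c : Fin n → K →+ ℝ} (hc : IsHermitianCoords c)
include hc

lemma energy_eq {q : ℝ} (y : Fin N → Vec K d) :
    energy q y = ∑ i, ∑ j, ‖herm (y i) (y j)‖ ^ q - ∑ i, ‖y i‖ ^ (2 * q) := by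
  rw [energy, eq_sub_iff_add_eq, ← Fintype.sum_prod_type' (f := fun i j => ‖herm (y i) (y j)‖ ^ q),
    ← Finset.univ_product_univ, ← Finset.diag_union_offDiag,
    Finset.sum_union (Finset.disjoint_diag_offDiag _), Finset.sum_diag, add_comm]
  congr 1
  refine Finset.sum_congr rfl fun i _ => ?_
  rw [hc.norm_herm_self, ← Real.rpow_two, ← Real.rpow_mul (norm_nonneg _)]

variable [NormedAlgebra ℝ K]

lemma consistsOfUnitReps_of_two_valued (hn : Module.finrank ℝ K = n) (hn0 : 1 ≤ n) (hd : 1 ≤ d)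
    (hN : 1 ≤ N) {y : Fin N → Vec K d} (hy : IsTightFrame ((N : ℝ) / d) y) {B : ℝ}
    (hB : B = 1 / (d + 2 / n)) (hr : ∀ i, ‖y i‖ = 1)
    (hs : ∀ i j, ‖herm (y i) (y j)‖ ^ 2 = B ∨ ‖herm (y i) (y j)‖ ^ 2 = 1) :
    ConsistsOfUnitRepsOfMaximalSimplex y := by
  classical
  have hd1 : (1 : ℝ) ≤ d := by exact_mod_cast hd
  have hn1 : (1 : ℝ) ≤ n := by exact_mod_cast hn0
  have hN1 : (1 : ℝ) ≤ N := by exact_mod_cast hN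
  have hμ : (0 : ℝ) < 2 / n := by positivity
  have hB1 : B < 1 := by rw [hB, div_lt_one (by positivity)]; linarith
  have hy0 : ∀ i, y i ≠ 0 := fun i h => by simpa [h] using hr i
  set P : Fin N → ProjSpace K d := fun i => Projectivization.mk Kᵐᵒᵖ (y i) (hy0 i) with hP
  have hrep : ∀ i, IsUnitRep (y i) (P i) := fun i => ⟨hr i, hy0 i, rfl⟩
  have h2 : ∀ i j, P i ≠ P j → ‖herm (y i) (y j)‖ ^ 2 = B := by
    intro i j hij
    refine (hs i j).resolve_right fun h => hij ?_
    exact hc.mk_eq_mk_of_norm_herm (hr i) (hr j) _ _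
      ((pow_eq_one_iff_of_nonneg (norm_nonneg _) two_ne_zero).1 h)
  have h1 : ∀ i j, P i = P j → ‖herm (y i) (y j)‖ ^ 2 = 1 := by
    intro i j hij
    rw [hc.norm_herm_eq_one_of_isUnitRep (hrep i) (hij ▸ hrep j), one_pow]
  refine ⟨Finset.univ.image P, ⟨⟨√B, ?_⟩, ?_⟩, fun i => ⟨P i, by simp, hrep i⟩, ?_⟩
  · intro p hp p' hp' hne u v hu hv
    obtain ⟨i, -, rfl⟩ := Finset.mem_image.1 hp
    obtain ⟨j, -, rfl⟩ := Finset.mem_image.1 hp'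
    rw [hc.norm_herm_eq_of_isUnitRep hu (hrep i) hv (hrep j), ← h2 i j hne,
      Real.sqrt_sq (norm_nonneg _)]
  -- The count gives |S| (1/d - B) = 1 - B, the equation satisfied by M.
  · have hcount := card_mul_eq P (fun i j => ‖herm (y i) (y j)‖ ^ 2) (Finset.univ.image P)
      (A := (N : ℝ) / d) (by simp) (by simp) h1 h2 (fun i => by rw [hy (y i), hr]; ring)
    have hrel := simplexSize_relation hd1 hμ hB
    rw [Fintype.card_fin] at hcount
    rw [simplexSize, hn]
    rw [div_div_eq_mul_div] at hrel
    have hne : 1 / (d : ℝ) - B ≠ 0 := by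
      intro h0
      rw [h0, mul_zero] at hrel
      linarith
    refine mul_right_cancel₀ (mul_ne_zero (by linarith : (N : ℝ) ≠ 0) hne) ?_
    calc _ = (N : ℝ) * (1 - B) := by rw [hcount]; ring
      _ = _ := by rw [← hrel]; ring
  · intro p hp
    obtain ⟨i, -, rfl⟩ := Finset.mem_image.1 hp
    exact ⟨i, hrep i⟩

lemma energy_eq_of_consistsOfUnitReps (hn : Module.finrank ℝ K = n) (hn0 : 1 ≤ n) (hd : 1 ≤ d)
    (hN : 1 ≤ N) {q : ℝ} {y : Fin N → Vec K d} (hy : IsTightFrame ((N : ℝ) / d) y) {B : ℝ}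
    (hB : B = 1 / (d + 2 / n)) (h : ConsistsOfUnitRepsOfMaximalSimplex y) :
    energy q y = N ^ 2 * momentBound d (2 / n) (q / 2) B - N := by
  classical
  have hd1 : (1 : ℝ) ≤ d := by exact_mod_cast hd
  have hn1 : (1 : ℝ) ≤ n := by exact_mod_cast hn0
  have hN1 : (1 : ℝ) ≤ N := by exact_mod_cast hN
  have hμ : (0 : ℝ) < 2 / n := by positivity
  have hB0 : 0 < B := by rw [hB]; positivity
  have hB1 : B < 1 := by rw [hB, div_lt_one (by positivity)]; linarith
  obtain ⟨S, ⟨⟨α, hα⟩, hcard⟩, hyS, hSy⟩ := h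
  choose P hPS hrep using hyS
  have hr : ∀ i, ‖y i‖ = 1 := fun i => (hrep i).1
  have h1 : ∀ i j, P i = P j → ‖herm (y i) (y j)‖ ^ 2 = 1 := by
    intro i j hij
    rw [hc.norm_herm_eq_one_of_isUnitRep (hrep i) (hij ▸ hrep j), one_pow]
  have h2 : ∀ i j, P i ≠ P j → ‖herm (y i) (y j)‖ ^ 2 = α ^ 2 := fun i j hij => by
    rw [hα _ (hPS i) _ (hPS j) hij _ _ (hrep i) (hrep j)]
  have hrow : ∀ i, ∑ j, ‖herm (y i) (y j)‖ ^ 2 = (N : ℝ) / d := fun i => by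
    rw [hy (y i), hr]; ring
  have hcount := card_mul_eq P (fun i j => ‖herm (y i) (y j)‖ ^ 2) S hPS
    (fun p hp => by
      obtain ⟨i, hi⟩ := hSy p hp
      refine ⟨i, ?_⟩
      obtain ⟨_, _, e⟩ := hi
      obtain ⟨_, _, e'⟩ := hrep i
      exact e'.symm.trans e) h1 h2 hrow
  have hrel := simplexSize_relation hd1 hμ hB
  rw [Fintype.card_fin] at hcount
  set M : ℝ := d + ((d : ℝ) ^ 2 - d) / (2 / n) with hM
  have hSM : (S.card : ℝ) = M := by
    rw [hcard, simplexSize, hn, hM, div_div_eq_mul_div]; ring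
  rw [hSM] at hcount
  have hcount' : 1 - α ^ 2 = M * (1 / d - α ^ 2) := by
    refine mul_left_cancel₀ (by linarith : (N : ℝ) ≠ 0) (hcount.trans ?_)
    ring
  have hB2 : ∀ i j, P i ≠ P j → ‖herm (y i) (y j)‖ ^ 2 = B := by
    intro i j hij
    -- A pair of different points makes M > 1, so the count determines α². If M = 1 there is no such
    -- pair and α is arbitrary.
    have hlt : 1 < S.card := Finset.one_lt_card.2 ⟨_, hPS i, _, hPS j, hij⟩
    have hM1 : 1 < M := by rw [← hSM]; exact_mod_cast hlt
    rw [h2 i j hij]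
    refine mul_left_cancel₀ (by linarith : M - 1 ≠ 0) ?_
    linarith
  -- On the two values B and 1 the power agrees with its chord, so the energy depends only on the
  -- row sums of squares.
  have hpow : ∀ i j, ‖herm (y i) (y j)‖ ^ q =
      B ^ (q / 2) + (1 - B ^ (q / 2)) / (1 - B) * (‖herm (y i) (y j)‖ ^ 2 - B) := by
    intro i j
    have e : ‖herm (y i) (y j)‖ ^ q = (‖herm (y i) (y j)‖ ^ 2) ^ (q / 2) := by
      rw [← Real.rpow_two, ← Real.rpow_mul (norm_nonneg _)]; ring_nf
    rw [e]
    by_cases hij : P i = P j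
    · rw [h1 i j hij, Real.one_rpow, div_mul_cancel₀ _ (by linarith : 1 - B ≠ 0)]
      ring
    · rw [hB2 i j hij]
      ring
  rw [hc.energy_eq]
  simp only [hpow, hr, Real.one_rpow, Finset.sum_add_distrib, ← Finset.mul_sum,
    Finset.sum_sub_distrib, hrow]
  simp only [Finset.sum_const, Finset.card_univ, Fintype.card_fin, nsmul_eq_mul, mul_one]
  rw [momentBound, ← hM]
  have hM0 : M ≠ 0 := by
    intro h0
    rw [h0, zero_mul] at hrel
    linarith
  have h1B : 1 - B ≠ 0 := by linarith
  have hdd : (1 : ℝ) / d = (1 - B) / M + B := by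
    rw [eq_comm, ← eq_sub_iff_add_eq, div_eq_iff hM0, ← hrel]
    ring
  rw [div_eq_mul_one_div (N : ℝ) d, hdd]
  field_simp
  ring

theorem energy_le_and_eq_iff (hn : Module.finrank ℝ K = n) (hn124 : n = 1 ∨ n = 2 ∨ n = 4)
    (hd : 1 ≤ d) (hN : 1 ≤ N) {q : ℝ} (hq1 : 1 ≤ q) (hq2 : q ≤ 2) (y : Fin N → Vec K d)
    (hy : IsTightFrame ((N : ℝ) / d) y) :
    energy q y ≤ energyBound K d N q ∧
      (q < 2 → (energy q y = energyBound K d N q ↔ ConsistsOfUnitRepsOfMaximalSimplex y)) := by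
  have hn0 : 1 ≤ n := by omega
  have hm : (n : ℝ) = 1 ∨ (n : ℝ) = 2 ∨ (n : ℝ) = 4 := by
    rcases hn124 with rfl | rfl | rfl <;> simp
  have hn1 : (1 : ℝ) ≤ n := by exact_mod_cast hn0
  obtain ⟨B, hB⟩ : ∃ B : ℝ, B = 1 / (d + 2 / n) := ⟨_, rfl⟩
  have hB0 : 0 ≤ B := by rw [hB]; positivity
  have hbound : energyBound K d N q = N ^ 2 * momentBound d (2 / n) (q / 2) B - N := by
    have hβ : beta K d ^ q = B ^ (q / 2) := by
      rw [beta, hn, ← div_eq_mul_inv, ← hB, Real.sqrt_eq_rpow, ← Real.rpow_mul hB0]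
      ring_nf
    rw [energyBound, hβ, momentBound, simplexSize, hn, div_div_eq_mul_div, div_mul_eq_mul_div]
  have hf := hc.frameNumbers hd hn0 y hy
  rw [hbound]
  rcases hq2.lt_or_eq with hlt | rfl
  · have h := hf.energy_le_of_lt_two hd hm hB hq1 hlt
    rw [← hc.energy_eq] at h
    refine ⟨h.1, fun _ => ⟨fun he => ?_, hc.energy_eq_of_consistsOfUnitReps hn hn0 hd hN hy hB⟩⟩
    obtain ⟨hr, hs⟩ := h.2 he
    exact hc.consistsOfUnitReps_of_two_valued hn hn0 hd hN hy hB hr hs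
  · have h := hf.energy_two_le hd (by linarith) hB
    rw [← hc.energy_eq] at h
    exact ⟨h, fun h => absurd h (lt_irrefl _)⟩

end IsHermitianCoords

lemma isHermitianCoords_real : IsHermitianCoords (K := ℝ) ![AddMonoidHom.id ℝ] where
  self a := by simp [coordForm, sq]
  mul_left a b e := by simp [coordForm]; ring
  mul_right a b e := by simp [coordForm]; ring

lemma isHermitianCoords_complex :
    IsHermitianCoords (K := ℂ) ![Complex.reAddGroupHom, Complex.imAddGroupHom] where
  self a := by simp [coordForm, Complex.sq_norm, Complex.normSq_apply]
  mul_left a b e := by simp [coordForm]; ring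
  mul_right a b e := by simp [coordForm]; ring

/-- The four real coordinates of a quaternion. -/
def quaternionCoords : Fin 4 → ℍ[ℝ] →+ ℝ :=
  ![⟨⟨fun a => a.re, rfl⟩, fun _ _ => rfl⟩, ⟨⟨fun a => a.imI, rfl⟩, fun _ _ => rfl⟩,
    ⟨⟨fun a => a.imJ, rfl⟩, fun _ _ => rfl⟩, ⟨⟨fun a => a.imK, rfl⟩, fun _ _ => rfl⟩]

lemma coordForm_quaternionCoords (a b : ℍ[ℝ]) : coordForm quaternionCoords a b =
    a.re * b.re + a.imI * b.imI + a.imJ * b.imJ + a.imK * b.imK := by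
  rw [coordForm, Fin.sum_univ_four]
  rfl

lemma isHermitianCoords_quaternion : IsHermitianCoords quaternionCoords where
  self a := by
    rw [coordForm_quaternionCoords, sq ‖a‖, ← Quaternion.normSq_eq_norm_mul_self,
      Quaternion.normSq_def']
    ring
  mul_left a b e := by
    simp only [coordForm_quaternionCoords, Quaternion.re_mul, Quaternion.imI_mul,
      Quaternion.imJ_mul, Quaternion.imK_mul, Quaternion.re_star, Quaternion.imI_star,
      Quaternion.imJ_star, Quaternion.imK_star]
    ring
  mul_right a b e := by
    simp only [coordForm_quaternionCoords, Quaternion.re_mul, Quaternion.imI_mul,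
      Quaternion.imJ_mul, Quaternion.imK_mul, Quaternion.re_star, Quaternion.imI_star,
      Quaternion.imJ_star, Quaternion.imK_star]
    ring

end Main

theorem mainTheorem10 (d N : ℕ) (hd : 1 ≤ d) (hN : 1 ≤ N) (q : ℝ) (hq1 : 1 ≤ q) (hq2 : q ≤ 2) :
    (∀ y : Fin N → ProjFrame.Vec ℝ d, ProjFrame.IsTightFrame ((N : ℝ) / d) y →
      ProjFrame.energy q y ≤ ProjFrame.energyBound ℝ d N q ∧
      (q < 2 → (ProjFrame.energy q y = ProjFrame.energyBound ℝ d N q ↔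
        ProjFrame.ConsistsOfUnitRepsOfMaximalSimplex y))) ∧
    (∀ y : Fin N → ProjFrame.Vec ℂ d, ProjFrame.IsTightFrame ((N : ℝ) / d) y →
      ProjFrame.energy q y ≤ ProjFrame.energyBound ℂ d N q ∧
      (q < 2 → (ProjFrame.energy q y = ProjFrame.energyBound ℂ d N q ↔
        ProjFrame.ConsistsOfUnitRepsOfMaximalSimplex y))) ∧
    (∀ y : Fin N → ProjFrame.Vec ℍ[ℝ] d, ProjFrame.IsTightFrame ((N : ℝ) / d) y →
      ProjFrame.energy q y ≤ ProjFrame.energyBound ℍ[ℝ] d N q ∧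
      (q < 2 → (ProjFrame.energy q y = ProjFrame.energyBound ℍ[ℝ] d N q ↔
        ProjFrame.ConsistsOfUnitRepsOfMaximalSimplex y))) :=
  ⟨isHermitianCoords_real.energy_le_and_eq_iff (Module.finrank_self ℝ) (by simp) hd hN hq1 hq2,
    isHermitianCoords_complex.energy_le_and_eq_iff Complex.finrank_real_complex (by simp) hd hN
      hq1 hq2,
    isHermitianCoords_quaternion.energy_le_and_eq_iff Quaternion.finrank_eq_four (by simp) hd hN
      hq1 hq2⟩
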